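/- Let $\mathbb P$ be the set of primes, $p_0<p_1<\cdots$ its increasing enumeration, and give $2^{\mathbb P}$, the space of all subsets $W\subseteq\mathbb P$, the product (Cantor) topology. For a finite binary string $\sigma$ let $\mathcal U_\sigma$ be the basic open set of those $W$ whose characteristic sequence $(\chi_W(p_0),\chi_W(p_1),\dots)$ begins with $\sigma$. Let $R_W=\mathbb Z[\tfrac1p : p\in W]\subseteq\mathbb Q$; every subring of $\mathbb Q$ is $R_W$ for exactly one $W$. For a commutative ring $R$, let $\mathrm{HTP}(R)$ be the set of polynomials over $R$ in the variables $X_0,X_1,\dots$ that have a zero in $R$. For $f\in\mathbb Z[X_0,X_1,\dots]$ let $\mathcal A(f)=\{W : f\in \mathrm{HTP}(R_W)\}$, and let $\mathcal B(f)$ be the set of those $W$ that lie neither in $\mathcal A(f)$ nor in the interior of the complement of $\mathcal A(f)$. A set $W$, and the ring $R_W$, is called HTP-generic if $W\notin\mathcal B(f)$ for every $f\in\mathbb Z[X_0,X_1,\dots]$. A polynomial $g\in\mathbb Z[X,Y_0,Y_1,\dots]$ existentially defines $\mathbb Z$ in $R$ if for every $q\in R$: $q\in\mathbb Z$ if and only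 if $g(q,\vec Y)\in\mathrm{HTP}(R)$. $\mathbb Z$ is existentially definable in $R$ if such a $g$ exists. Let $\mathcal E=\{W\subseteq\mathbb P : \mathbb Z \text{ is existentially definable in } R_W\}$. **Theorem 5.4.** The following are equivalent. 1. The class $\mathcal E$ is not meager in $2^{\mathbb P}$. 2. There are a finite binary string $\sigma$ and a single polynomial $g\in\mathbb Z[X,\vec Y]$ that existentially defines $\mathbb Z$ in $R_V$ for every HTP-generic $V\in\mathcal U_\sigma$. 3. $\mathbb Z$ is existentially definable in $\mathbb Q$. 4. There is a single existential formula that defines $\mathbb Z$ in every subring of $\mathbb Q$. Here (4) may be read in either of two ways, and both are equivalent to (1)–(3): (4a) some existential first-order formula $\varphi(X)$ in the language of rings defines $\mathbb Z$ in every subring of $\mathbb Q$; (4b) some single polynomial $g\in\mathbb Z[X,\vec Y]$ existentially defines $\mathbb Z$ in every subring of $\mathbb Q$. -/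

import Mathlib

namespace SubringsOfRat

/-- The space `2^P` of all sets of primes, a set being identified with its characteristic function;
the topology is the product topology, with `Bool` discrete (Cantor space). -/
abbrev PrimeSets : Type := Nat.Primes → Bool

/-- The `i`-th prime, starting with `2` for `i = 0`. -/
noncomputable def nthPrime (i : ℕ) : Nat.Primes :=
  ⟨Nat.nth Nat.Prime i, Nat.prime_nth_prime i⟩

/-- The basic open set `U_σ` of all `W` whose characteristic sequence begins with the finite binary
string `σ`. -/
def basicOpen (σ : List Bool) : Set PrimeSets :=
  {W | ∀ (i : ℕ) (hi : i < σ.length), W (nthPrime i) = σ[i]}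

/-- The subring `R_W = ℤ[1/p : p ∈ W]` of `ℚ`. -/
def R (W : PrimeSets) : Subring ℚ :=
  Subring.closure {q : ℚ | ∃ p : Nat.Primes, W p = true ∧ q = 1 / ((p : ℕ) : ℚ)}

/-- Hilbert's Tenth Problem for `A`: the polynomials over `A`, in the variables `X₀, X₁, …`,
that have a zero in `A`. -/
def HTP (A : Type*) [CommRing A] : Set (MvPolynomial ℕ A) :=
  {f | ∃ x : ℕ → A, MvPolynomial.eval x f = 0}

/-- `𝒜(f)`, the class of all `W` such that the integer polynomial `f` has a zero in `R_W`. -/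
def solvable (f : MvPolynomial ℕ ℤ) : Set PrimeSets :=
  {W | MvPolynomial.map (Int.castRingHom (R W)) f ∈ HTP (R W)}

/-- The boundary `ℬ(f)`: all `W` lying neither in `𝒜(f)` nor in the interior of its complement. -/
def boundary (f : MvPolynomial ℕ ℤ) : Set PrimeSets :=
  {W | W ∉ solvable f ∧ W ∉ interior (solvable f)ᶜ}

/-- `W` (or `R_W`) is HTP-generic if it lies in the boundary of no integer polynomial. -/
def HTPGeneric (W : PrimeSets) : Prop :=
  W ∉ ⋃ f : MvPolynomial ℕ ℤ, boundary f

/-- Polynomials `g(X, Y₀, Y₁, …)` over `ℤ`: the variable `X` is `none`, and `Y_i` is `some i`. -/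
abbrev PolyXY : Type := MvPolynomial (Option ℕ) ℤ

/-- The polynomial `g(q, Y₀, Y₁, …)` over `A`, for `q ∈ A`. -/
noncomputable def substX {A : Type*} [CommRing A] (g : PolyXY) (q : A) : MvPolynomial ℕ A :=
  MvPolynomial.aeval (fun o : Option ℕ => o.elim (MvPolynomial.C q) MvPolynomial.X) g

/-- `g` existentially defines `ℤ` in `A`: for all `q ∈ A`, `q ∈ ℤ ↔ g(q, Y₀, Y₁, …) ∈ HTP(A)`. -/
def ExistentiallyDefinesInt (A : Type*) [CommRing A] (g : PolyXY) : Prop :=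
  ∀ q : A, (∃ n : ℤ, (n : A) = q) ↔ substX g q ∈ HTP A

/-- `ℤ` is existentially definable in `A`. -/
def IntExistentiallyDefinable (A : Type*) [CommRing A] : Prop :=
  ∃ g : PolyXY, ExistentiallyDefinesInt A g

/-- The class `ℰ` of the subrings of `ℚ` in which `ℤ` is existentially definable. -/
def E : Set PrimeSets :=
  {W | IntExistentiallyDefinable (R W)}

/-- The first-order formula `φ(X)` in the language of rings defines `ℤ` in the ring `A`. -/
def FormulaDefinesInt (A : Type*) [CommRing A]
    (φ : FirstOrder.Language.ring.Formula (Fin 1)) : Prop :=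
  letI := FirstOrder.Ring.compatibleRingOfRing A
  ∀ q : A, (∃ n : ℤ, (n : A) = q) ↔ φ.Realize (fun _ => q)

end SubringsOfRat

/-! A solution of an equation in `R W` inverts only finitely many primes, so solvability is an open
condition on `W`, and it persists when `W` grows. There are countably many polynomials, so if `E` is
not meager, one `g` works on a set that is dense in some basic open set of `σ`. Openness shows that
for every `V` in that set, solvability of `g(q, Y)` in `R V` forces `q` to be an integer. For an
integer `q`, unsolvability at an HTP-generic `V` persists on a neighborhood of `V`, which meets the
dense set: a contradiction. Conversely, the generic sets are comeager, and Baire's theorem gives (2)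
→ (1).

To reach `ℚ`, let `W` be the largest set of primes compatible with `σ`. Openness and monotonicity
transfer `g` from the generic sets to `W`. Only finitely many primes are not inverted in `R W`, so
it is a finite intersection of rings of `p`-integral rationals. Each of these is diophantine in `ℚ`,
hence so is `ℤ`.

The existential definition of `p`-integrality (`AuxiliaryPrimes.not_dvd_den_iff`) asks that `1 + p
r²` be a norm from `ℚ(√m)` for some `m` constrained by three further quadratic equations. These make
`ℚ_p(√m)` the unramified quadratic extension, whose norms have even valuation, whereas `1 + p r²`
has odd valuation if `r` is not `p`-integral. Conversely, for a `p`-integral `r`, Dirichlet's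
theorem on primes provides `m`, and Legendre's theorem on ternary forms, with quadratic reciprocity,
solves the equations.

Finally, a definition in `ℚ` passes to all subrings at once: rational witnesses are written with a
common denominator, whose nonvanishing is expressed by Lagrange's four squares. -/

namespace SubringsOfRat
-- Local theory: norm forms over the `p`-adic numbers.
namespace Padics

variable {p : ℕ} [Fact p.Prime]

lemma unit_coe_ne_zero {u : ℤ_[p]} (hu : IsUnit u) : (u : ℚ_[p]) ≠ 0 := by
  intro h
  have : ‖(u : ℚ_[p])‖ = 1 := PadicInt.isUnit_iff.mp hu
  rw [h, norm_zero] at this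
  exact zero_ne_one this

lemma prime_ne_zero : (p : ℚ_[p]) ≠ 0 := by
  exact_mod_cast (Fact.out : p.Prime).ne_zero

lemma valuation_zpow_mul_unit (k : ℤ) {u : ℤ_[p]} (hu : IsUnit u) :
    ((p : ℚ_[p]) ^ k * u).valuation = k := by
  have hp : (p : ℚ_[p]) ≠ 0 := prime_ne_zero
  have hu0 := unit_coe_ne_zero hu
  have hv : (u : ℚ_[p]).valuation = 0 := by
    have h1 : ‖(u : ℚ_[p])‖ = 1 := PadicInt.isUnit_iff.mp hu
    rw [Padic.norm_eq_zpow_neg_valuation hu0] at h1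
    have hp1 : (1 : ℝ) < p := by exact_mod_cast (Fact.out : p.Prime).one_lt
    have := (zpow_eq_one_iff_right₀ (by positivity) hp1.ne').mp h1
    omega
  rw [Padic.valuation_mul (zpow_ne_zero _ hp) hu0, Padic.valuation_zpow, Padic.valuation_p, hv]
  ring

lemma exists_zpow_mul_unit {a : ℚ_[p]} (ha : a ≠ 0) :
    ∃ u : ℤ_[p], IsUnit u ∧ a = (p : ℚ_[p]) ^ a.valuation * u := by
  have hp : (p : ℚ_[p]) ≠ 0 := prime_ne_zero
  have hp1 : (p : ℝ) ≠ 0 := by exact_mod_cast (Fact.out : p.Prime).ne_zero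
  have hn : ‖a * (p : ℚ_[p]) ^ (-a.valuation)‖ = 1 := by
    rw [norm_mul, Padic.norm_eq_zpow_neg_valuation ha, norm_zpow, Padic.norm_p, inv_zpow', neg_neg,
      ← zpow_add₀ hp1]
    simp
  refine ⟨⟨_, hn.le⟩, PadicInt.isUnit_iff.mpr hn, ?_⟩
  change a = _ * (a * _)
  rw [mul_left_comm, ← zpow_add₀ hp]
  simp

/-- Two `p`-adic numbers, not both zero, are a power of `p` times a primitive pair. -/
lemma exists_primitive {x y : ℚ_[p]} (h : x ≠ 0 ∨ y ≠ 0) :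
    ∃ (k : ℤ) (x' y' : ℤ_[p]), x = (p : ℚ_[p]) ^ k * x' ∧ y = (p : ℚ_[p]) ^ k * y' ∧
      (IsUnit x' ∨ IsUnit y') := by
  have hp : (p : ℚ_[p]) ≠ 0 := prime_ne_zero
  have key : ∀ {x y : ℚ_[p]}, x ≠ 0 → ‖y‖ ≤ ‖x‖ →
      ∃ (k : ℤ) (x' y' : ℤ_[p]), x = (p : ℚ_[p]) ^ k * x' ∧ y = (p : ℚ_[p]) ^ k * y' ∧
        IsUnit x' := by
    intro x y hx hxy
    obtain ⟨u, hu, hxu⟩ := exists_zpow_mul_unit hx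
    have hnx : ‖x‖ = ‖(p : ℚ_[p]) ^ x.valuation‖ := by
      have : ‖(u : ℚ_[p])‖ = 1 := PadicInt.isUnit_iff.mp hu
      conv_lhs => rw [hxu]
      rw [norm_mul, this, mul_one]
    have hpos : 0 < ‖(p : ℚ_[p]) ^ x.valuation‖ := norm_pos_iff.mpr (zpow_ne_zero _ hp)
    have hle : ‖y / (p : ℚ_[p]) ^ x.valuation‖ ≤ 1 := by
      rw [norm_div, div_le_one hpos, ← hnx]
      exact hxy
    refine ⟨x.valuation, u, ⟨_, hle⟩, hxu, ?_, hu⟩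
    change y = _ * (y / _)
    field_simp
  rcases le_total ‖y‖ ‖x‖ with hxy | hxy
  · have hx : x ≠ 0 := by
      rintro rfl
      simp only [norm_zero, norm_le_zero_iff] at hxy
      simp [hxy] at h
    obtain ⟨k, x', y', h1, h2, h3⟩ := key hx hxy
    exact ⟨k, x', y', h1, h2, Or.inl h3⟩
  · have hy : y ≠ 0 := by
      rintro rfl
      simp only [norm_zero, norm_le_zero_iff] at hxy
      simp [hxy] at h
    obtain ⟨k, x', y', h1, h2, h3⟩ := key hy hxy
    exact ⟨k, y', x', h2, h1, Or.inr h3⟩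

/-- The binary form `X² - μY²` takes only values of even valuation. -/
def EvenNorms (μ : ℤ_[p]) : Prop :=
  ∀ x y : ℚ_[p], x ≠ 0 ∨ y ≠ 0 → Even (x ^ 2 - μ * y ^ 2).valuation

lemma isUnit_iff_toZMod_ne_zero {z : ℤ_[p]} : IsUnit z ↔ PadicInt.toZMod z ≠ 0 := by
  rw [Ne, ← RingHom.mem_ker, PadicInt.ker_toZMod, IsLocalRing.mem_maximalIdeal, mem_nonunits_iff,
    not_not]

/-- At a primitive pair the form is a unit, since a zero modulo `p` would exhibit `μ` as a square of
the residue field; scaling by `p ^ k` adds `2k` to the valuation. -/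
lemma evenNorms_of_nonsquare {μ : ℤ_[p]} (hμ : ¬ IsSquare (PadicInt.toZMod μ)) : EvenNorms μ := by
  intro x y hxy
  obtain ⟨k, x', y', rfl, rfl, hu⟩ := exists_primitive hxy
  have hunit : IsUnit (x' ^ 2 - μ * y' ^ 2) := by
    rw [isUnit_iff_toZMod_ne_zero] at hu ⊢
    rw [isUnit_iff_toZMod_ne_zero] at hu
    simp only [map_sub, map_mul, map_pow]
    intro h0
    by_cases hy : PadicInt.toZMod y' = 0
    · rw [hy] at h0
      have : PadicInt.toZMod x' = 0 := by simpa using h0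
      tauto
    · apply hμ
      refine ⟨PadicInt.toZMod x' / PadicInt.toZMod y', ?_⟩
      field_simp
      linear_combination -h0
  have : ((p : ℚ_[p]) ^ k * x') ^ 2 - μ * ((p : ℚ_[p]) ^ k * y') ^ 2 =
      (p : ℚ_[p]) ^ (2 * k) * ((x' ^ 2 - μ * y' ^ 2 : ℤ_[p]) : ℚ_[p]) := by
    push_cast
    rw [two_mul, zpow_add₀ prime_ne_zero]
    ring
  rw [this, valuation_zpow_mul_unit _ hunit]
  exact even_two_mul k

/-- Reduction of `2`-adic integers modulo `8`. -/
noncomputable abbrev modEight : ℤ_[2] →+* ZMod 8 := PadicInt.toZModPow (p := 2) 3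

lemma isUnit_of_modEight {z : ℤ_[2]} (h : IsUnit (modEight z)) : IsUnit z := by
  by_contra hz
  rw [← mem_nonunits_iff, ← IsLocalRing.mem_maximalIdeal, PadicInt.maximalIdeal_eq_span_p,
    Ideal.mem_span_singleton] at hz
  obtain ⟨w, rfl⟩ := hz
  rw [map_mul, map_natCast] at h
  have : ∀ w : ZMod 8, ¬ IsUnit (((2 : ℕ) : ZMod 8) * w) := by decide
  exact this _ h

lemma eq_add_eight_mul {z w : ℤ_[2]} (h : modEight z = modEight w) : ∃ t, z = w + 8 * t := by
  have h1 : z - w ∈ RingHom.ker modEight := by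
    rw [RingHom.mem_ker, map_sub, h, sub_self]
  rw [PadicInt.ker_toZModPow, Ideal.mem_span_singleton] at h1
  obtain ⟨t, ht⟩ := h1
  refine ⟨t, ?_⟩
  have : ((2 : ℕ) : ℤ_[2]) ^ 3 = 8 := by norm_num
  rw [this] at ht
  linear_combination ht

lemma coe_ofNat (n : ℕ) [n.AtLeastTwo] : ((OfNat.ofNat n : ℤ_[p]) : ℚ_[p]) = OfNat.ofNat n :=
  map_ofNat (PadicInt.Coe.ringHom (p := p)) n

/-- At a primitive pair the value is a unit, or both arguments are odd and it is `4` modulo `8`,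
hence of valuation exactly `2`. -/
lemma evenNorms_of_modEight {μ : ℤ_[2]} (hμ : modEight μ = 5) : EvenNorms μ := by
  intro x y hxy
  obtain ⟨k, x', y', rfl, rfl, hu⟩ := exists_primitive hxy
  have hu' : IsUnit (modEight x') ∨ IsUnit (modEight y') := hu.imp (·.map _) (·.map _)
  have hdec : ∀ a b : ZMod 8, (IsUnit a ∨ IsUnit b) → IsUnit (a ^ 2 - 5 * b ^ 2) ∨
      a ^ 2 - 5 * b ^ 2 = 4 := by decide
  have hcase := hdec _ _ hu'
  have hpow : (((2 : ℕ) : ℚ_[2]) ^ k * x') ^ 2 - μ * (((2 : ℕ) : ℚ_[2]) ^ k * y') ^ 2 =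
      ((2 : ℕ) : ℚ_[2]) ^ (2 * k) * ((x' ^ 2 - μ * y' ^ 2 : ℤ_[2]) : ℚ_[2]) := by
    push_cast
    rw [two_mul, zpow_add₀ (by norm_num)]
    ring
  rw [← hμ, ← map_pow, ← map_pow, ← map_mul, ← map_sub] at hcase
  rw [hpow]
  rcases hcase with h | h
  · rw [valuation_zpow_mul_unit _ (isUnit_of_modEight h)]
    exact even_two_mul k
  · obtain ⟨t, ht⟩ := eq_add_eight_mul (z := x' ^ 2 - μ * y' ^ 2) (w := 4)
      (by rw [h]; exact (map_ofNat modEight 4).symm)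
    have hunit : IsUnit (1 + 2 * t : ℤ_[2]) := by
      apply isUnit_of_modEight
      have : ∀ w : ZMod 8, IsUnit (1 + 2 * w) := by decide
      have h2 : modEight (1 + 2 * t) = 1 + 2 * modEight t := by
        rw [map_add, map_one, map_mul, map_ofNat]
      rw [h2]
      exact this _
    have h4 : ((2 : ℕ) : ℚ_[2]) ^ (2 * k) * ((x' ^ 2 - μ * y' ^ 2 : ℤ_[2]) : ℚ_[2]) =
        ((2 : ℕ) : ℚ_[2]) ^ (2 * (k + 1)) * ((1 + 2 * t : ℤ_[2]) : ℚ_[2]) := by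
      rw [ht, mul_add, zpow_add₀ (by norm_num)]
      have e2 : ((2 : ℤ_[2]) : ℚ_[2]) = 2 := coe_ofNat 2
      have e4 : ((4 : ℤ_[2]) : ℚ_[2]) = 4 := coe_ofNat 4
      have e8 : ((8 : ℤ_[2]) : ℚ_[2]) = 8 := coe_ofNat 8
      push_cast
      rw [e2, e4, e8]
      norm_num
      ring
    rw [h4, valuation_zpow_mul_unit _ hunit]
    exact even_two_mul _

/-- If a form `X² - cpY²` with a unit `c` takes a unit value, then at integral arguments, the first
one being a unit. -/
lemma integral_of_ramified_form {c : ℤ_[p]} (hc : IsUnit c) {x y : ℚ_[p]} {u : ℤ_[p]}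
    (hu : IsUnit u) (h : x ^ 2 - c * p * y ^ 2 = u) :
    ∃ x' y' : ℤ_[p], u = x' ^ 2 - c * p * y' ^ 2 ∧ IsUnit x' := by
  have hxy : x ≠ 0 ∨ y ≠ 0 := by
    by_contra! h0
    rw [h0.1, h0.2] at h
    apply unit_coe_ne_zero hu
    rw [← h]
    ring
  obtain ⟨k, x', y', rfl, rfl, hprim⟩ := exists_primitive hxy
  have hpnu : ¬ IsUnit (p : ℤ_[p]) := PadicInt.prime_p.not_isUnit
  have hval := congrArg Padic.valuation h
  have hv0 : (u : ℚ_[p]).valuation = 0 := by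
    simpa using valuation_zpow_mul_unit 0 hu
  by_cases hx : IsUnit x'
  · have hunit : IsUnit (x' ^ 2 - c * p * y' ^ 2) := by
      rw [isUnit_iff_toZMod_ne_zero] at hx ⊢
      simp only [map_sub, map_mul, map_pow, map_natCast, CharP.cast_eq_zero, mul_zero, zero_mul,
        sub_zero]
      exact pow_ne_zero _ hx
    have hpow : ((p : ℚ_[p]) ^ k * x') ^ 2 - c * p * ((p : ℚ_[p]) ^ k * y') ^ 2 =
        (p : ℚ_[p]) ^ (2 * k) * ((x' ^ 2 - c * p * y' ^ 2 : ℤ_[p]) : ℚ_[p]) := by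
      push_cast
      rw [two_mul, zpow_add₀ prime_ne_zero]
      ring
    rw [hpow] at hval h
    rw [valuation_zpow_mul_unit _ hunit, hv0] at hval
    rw [hval, zpow_zero, one_mul] at h
    exact ⟨x', y', PadicInt.ext h.symm, hx⟩
  · exfalso
    have hy : IsUnit y' := hprim.resolve_left hx
    rw [← mem_nonunits_iff, ← IsLocalRing.mem_maximalIdeal, PadicInt.maximalIdeal_eq_span_p,
      Ideal.mem_span_singleton] at hx
    obtain ⟨w, rfl⟩ := hx
    have hunit : IsUnit (p * w ^ 2 - c * y' ^ 2) := by
      rw [isUnit_iff_toZMod_ne_zero] at hy hc ⊢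
      simp only [map_sub, map_mul, map_pow, map_natCast, CharP.cast_eq_zero, zero_mul, zero_sub]
      exact neg_ne_zero.mpr (mul_ne_zero hc (pow_ne_zero _ hy))
    have hpow : ((p : ℚ_[p]) ^ k * ((p * w : ℤ_[p]) : ℚ_[p])) ^ 2
          - c * p * ((p : ℚ_[p]) ^ k * y') ^ 2 =
        (p : ℚ_[p]) ^ (2 * k + 1) * ((p * w ^ 2 - c * y' ^ 2 : ℤ_[p]) : ℚ_[p]) := by
      push_cast
      rw [two_mul, zpow_add₀ prime_ne_zero, zpow_add₀ prime_ne_zero, zpow_one]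
      ring
    rw [hpow, valuation_zpow_mul_unit _ hunit, hv0] at hval
    omega

/-- A primitive sum of two squares is a unit or `2` modulo `8`. The latter has odd valuation, which
scaling cannot cancel, so a unit value forces scaling exponent `0`. -/
lemma integral_of_sum_two_squares {x y : ℚ_[2]} {u : ℤ_[2]} (hu : IsUnit u)
    (h : x ^ 2 + y ^ 2 = u) : ∃ x' y' : ℤ_[2], u = x' ^ 2 + y' ^ 2 := by
  have hxy : x ≠ 0 ∨ y ≠ 0 := by
    by_contra! h0
    rw [h0.1, h0.2] at h
    apply unit_coe_ne_zero hu
    rw [← h]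
    ring
  obtain ⟨k, x', y', rfl, rfl, hprim⟩ := exists_primitive hxy
  have hval := congrArg Padic.valuation h
  have hv0 : (u : ℚ_[2]).valuation = 0 := by
    simpa using valuation_zpow_mul_unit 0 hu
  have hu' : IsUnit (modEight x') ∨ IsUnit (modEight y') := hprim.imp (·.map _) (·.map _)
  have hdec : ∀ a b : ZMod 8, (IsUnit a ∨ IsUnit b) → IsUnit (a ^ 2 + b ^ 2) ∨
      a ^ 2 + b ^ 2 = 2 := by decide
  have hcase := hdec _ _ hu'
  have hpow : (((2 : ℕ) : ℚ_[2]) ^ k * x') ^ 2 + (((2 : ℕ) : ℚ_[2]) ^ k * y') ^ 2 =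
      ((2 : ℕ) : ℚ_[2]) ^ (2 * k) * ((x' ^ 2 + y' ^ 2 : ℤ_[2]) : ℚ_[2]) := by
    push_cast
    rw [two_mul, zpow_add₀ (by norm_num)]
    ring
  rw [← map_pow, ← map_pow, ← map_add] at hcase
  rw [hpow] at hval h
  rcases hcase with hc | hc
  · rw [valuation_zpow_mul_unit _ (isUnit_of_modEight hc), hv0] at hval
    rw [hval, zpow_zero, one_mul] at h
    exact ⟨x', y', PadicInt.ext h.symm⟩
  · exfalso
    obtain ⟨t, ht⟩ := eq_add_eight_mul (z := x' ^ 2 + y' ^ 2) (w := 2)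
      (by rw [hc]; exact (map_ofNat modEight 2).symm)
    have hunit : IsUnit (1 + 4 * t : ℤ_[2]) := by
      apply isUnit_of_modEight
      have : ∀ w : ZMod 8, IsUnit (1 + 4 * w) := by decide
      have h2 : modEight (1 + 4 * t) = 1 + 4 * modEight t := by
        rw [map_add, map_one, map_mul, map_ofNat]
      rw [h2]
      exact this _
    have h4 : ((2 : ℕ) : ℚ_[2]) ^ (2 * k) * ((x' ^ 2 + y' ^ 2 : ℤ_[2]) : ℚ_[2]) =
        ((2 : ℕ) : ℚ_[2]) ^ (2 * k + 1) * ((1 + 4 * t : ℤ_[2]) : ℚ_[2]) := by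
      rw [ht, zpow_add₀ (by norm_num)]
      have e2 : ((2 : ℤ_[2]) : ℚ_[2]) = 2 := coe_ofNat 2
      have e4 : ((4 : ℤ_[2]) : ℚ_[2]) = 4 := coe_ofNat 4
      have e8 : ((8 : ℤ_[2]) : ℚ_[2]) = 8 := coe_ofNat 8
      push_cast
      rw [e2, e4, e8]
      norm_num
      ring
    rw [h4, valuation_zpow_mul_unit _ hunit, hv0] at hval
    omega

/-- The term `p r²` dominates `1`, and its valuation is odd. -/
lemma odd_valuation_one_add_mul_sq {r : ℚ_[p]} (hr : ¬ ‖r‖ ≤ 1) :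
    Odd (1 + p * r ^ 2).valuation := by
  have hr0 : r ≠ 0 := by
    rintro rfl
    simp at hr
  rw [Padic.norm_le_one_iff_val_nonneg] at hr
  obtain ⟨u, hu, hru⟩ := exists_zpow_mul_unit hr0
  obtain ⟨j, hj⟩ : ∃ j : ℕ, r.valuation = -(j + 1 : ℤ) := ⟨(-r.valuation - 1).toNat, by omega⟩
  have hunit : IsUnit (u ^ 2 + (p : ℤ_[p]) ^ (2 * j + 1)) := by
    rw [isUnit_iff_toZMod_ne_zero] at hu ⊢
    simp only [map_add, map_pow, map_natCast, CharP.cast_eq_zero]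
    rw [zero_pow (by omega), add_zero]
    exact pow_ne_zero _ hu
  have hpow : 1 + p * r ^ 2 =
      (p : ℚ_[p]) ^ (-(2 * j + 1) : ℤ) * ((u ^ 2 + (p : ℤ_[p]) ^ (2 * j + 1) : ℤ_[p]) : ℚ_[p]) := by
    rw [hru, hj]
    push_cast
    rw [zpow_neg, zpow_neg]
    have hp : (p : ℚ_[p]) ≠ 0 := prime_ne_zero
    have e1 : (p : ℚ_[p]) ^ (j + 1 : ℤ) = (p : ℚ_[p]) ^ (j + 1) := by
      exact_mod_cast zpow_natCast (p : ℚ_[p]) (j + 1)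
    have e2 : (p : ℚ_[p]) ^ (2 * j + 1 : ℤ) = (p : ℚ_[p]) ^ (2 * j + 1) := by
      exact_mod_cast zpow_natCast (p : ℚ_[p]) (2 * j + 1)
    rw [e1, e2]
    field_simp
    ring
  rw [hpow, valuation_zpow_mul_unit _ hunit]
  exact ⟨-(j + 1), by ring⟩

/-- The local condition at `p` that `m` is, up to squares, a unit whose norm form takes only values
of even valuation. -/
lemma norm_le_one_of_forms {c : ℚ_[p]} {m₀ : ℤ_[p]} (hm₀ : EvenNorms m₀)
    (hμ : ∀ (μ : ℤ_[p]) (x y e f : ℚ_[p]), IsUnit μ → m₀ * μ = x ^ 2 - c * p * y ^ 2 →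
      (μ : ℚ_[p]) = e ^ 2 + f ^ 2 → EvenNorms μ)
    {r m x y z w s t e f : ℚ_[p]} (hm : m ≠ 0) (hn : 1 + p * r ^ 2 = x ^ 2 - m * y ^ 2)
    (h1 : m₀ * m = z ^ 2 - c * p * w ^ 2) (h2 : m = s ^ 2 - m₀ * t ^ 2) (h3 : m = e ^ 2 + f ^ 2) :
    ‖r‖ ≤ 1 := by
  by_contra hr
  have hodd := odd_valuation_one_add_mul_sq hr
  have hst : s ≠ 0 ∨ t ≠ 0 := by
    by_contra! h0
    rw [h0.1, h0.2] at h2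
    apply hm
    rw [h2]
    ring
  have heven : Even m.valuation := h2 ▸ hm₀ s t hst
  obtain ⟨j, hj⟩ := heven
  obtain ⟨μ, hunit, hmμ⟩ := exists_zpow_mul_unit hm
  have hq : (p : ℚ_[p]) ^ j ≠ 0 := zpow_ne_zero _ prime_ne_zero
  rw [hj, zpow_add₀ prime_ne_zero] at hmμ
  set q := (p : ℚ_[p]) ^ j
  have hgood : EvenNorms μ := by
    refine hμ μ (z / q) (w / q) (e / q) (f / q) hunit ?_ ?_
    · rw [hmμ] at h1
      field_simp
      linear_combination h1
    · rw [hmμ] at h3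
      field_simp
      linear_combination h3
  -- If both vanished, then `1 + p r² = 0`, whose valuation is `0` by convention and thus not odd.
  have hxy : x ≠ 0 ∨ q * y ≠ 0 := by
    by_contra! h0
    have hy : y = 0 := by simpa [hq] using h0.2
    rw [h0.1, hy] at hn
    rw [hn] at hodd
    simp at hodd
  have := hgood x (q * y) hxy
  rw [hn, hmμ] at hodd
  have e1 : x ^ 2 - μ * (q * y) ^ 2 = x ^ 2 - q * q * μ * y ^ 2 := by ring
  rw [e1] at this
  exact Int.not_even_iff_odd.mpr hodd this

/-- Modulo `p` the ramified form reduces to a nonzero square, so `m₀ μ` is a square; as `m₀` is not,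
neither is `μ`. -/
lemma norm_le_one_of_forms_of_odd {m₀ l : ℕ} (hm₀ : ¬ IsSquare (m₀ : ZMod p)) (hl : ¬ p ∣ l)
    {r m x y z w s t e f : ℚ_[p]} (hm : m ≠ 0) (hn : 1 + p * r ^ 2 = x ^ 2 - m * y ^ 2)
    (h1 : m₀ * m = z ^ 2 - l * p * w ^ 2) (h2 : m = s ^ 2 - m₀ * t ^ 2) (h3 : m = e ^ 2 + f ^ 2) :
    ‖r‖ ≤ 1 := by
  have hm₀' : ¬ IsSquare (PadicInt.toZMod (m₀ : ℤ_[p])) := by rwa [map_natCast]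
  have hlu : IsUnit (l : ℤ_[p]) := by
    rw [isUnit_iff_toZMod_ne_zero, map_natCast, Ne, ZMod.natCast_eq_zero_iff]
    exact hl
  refine norm_le_one_of_forms (c := l) (m₀ := (m₀ : ℤ_[p])) (evenNorms_of_nonsquare hm₀') ?_ hm hn
    (by exact_mod_cast h1) (by exact_mod_cast h2) h3
  intro μ x y e f hμ hxy _
  apply evenNorms_of_nonsquare
  have hm₀u : IsUnit (m₀ : ℤ_[p]) := by
    rw [isUnit_iff_toZMod_ne_zero]
    rintro h0
    exact hm₀' (h0 ▸ IsSquare.zero)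
  obtain ⟨x', y', h, hx'⟩ := integral_of_ramified_form (u := m₀ * μ) hlu (hm₀u.mul hμ)
    (x := x) (y := y) (by push_cast at hxy ⊢; exact hxy.symm)
  rintro ⟨a, ha⟩
  apply hm₀'
  have h' := congrArg PadicInt.toZMod h
  rw [isUnit_iff_toZMod_ne_zero, ha] at hμ
  have ha0 : a ≠ 0 := by
    rintro rfl
    simp at hμ
  simp only [map_sub, map_mul, map_pow, map_natCast, CharP.cast_eq_zero, mul_zero, zero_mul,
    sub_zero, ha] at h'
  refine ⟨PadicInt.toZMod x' / a, ?_⟩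
  rw [map_natCast]
  field_simp
  linear_combination h'

/-- Since `2l ≡ 6` modulo `8`, the ramified form gives `5μ ≡ 1` or `3`, according to the parity of
its second argument, so `μ ≡ 5` or `7`. Being a sum of two squares excludes `7`. -/
lemma norm_le_one_of_forms_two {m₀ l : ℕ} (hm₀ : m₀ % 8 = 5) (hl : l % 4 = 3)
    {r m x y z w s t e f : ℚ_[2]} (hm : m ≠ 0) (hn : 1 + (2 : ℕ) * r ^ 2 = x ^ 2 - m * y ^ 2)
    (h1 : m₀ * m = z ^ 2 - l * (2 : ℕ) * w ^ 2) (h2 : m = s ^ 2 - m₀ * t ^ 2)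
    (h3 : m = e ^ 2 + f ^ 2) : ‖r‖ ≤ 1 := by
  have hm₀8 : (m₀ : ZMod 8) = 5 := by
    rw [← ZMod.natCast_mod, hm₀]
    rfl
  have hl8 : (l : ZMod 8) = 3 ∨ (l : ZMod 8) = 7 := by
    have : l % 8 = 3 ∨ l % 8 = 7 := by omega
    rw [← ZMod.natCast_mod]
    rcases this with h | h <;> rw [h]
    · exact Or.inl rfl
    · exact Or.inr rfl
  have hm₀' : modEight (m₀ : ℤ_[2]) = 5 := by rw [map_natCast]; exact hm₀8
  have hl' : modEight (l : ℤ_[2]) = 3 ∨ modEight (l : ℤ_[2]) = 7 := by rw [map_natCast]; exact hl8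
  have hlu : IsUnit (l : ℤ_[2]) := by
    apply isUnit_of_modEight
    rcases hl' with h | h <;> rw [h] <;> decide
  have hm₀u : IsUnit (m₀ : ℤ_[2]) := by
    apply isUnit_of_modEight
    rw [hm₀']
    decide
  refine norm_le_one_of_forms (c := l) (m₀ := (m₀ : ℤ_[2])) (evenNorms_of_modEight hm₀') ?_ hm hn
    (by exact_mod_cast h1) (by exact_mod_cast h2) h3
  intro μ x y e f hμ hxy hef
  apply evenNorms_of_modEight
  obtain ⟨x', y', h, hx'⟩ := integral_of_ramified_form (u := m₀ * μ) hlu (hm₀u.mul hμ)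
    (x := x) (y := y) (by push_cast at hxy ⊢; exact hxy.symm)
  obtain ⟨e', f', h'⟩ := integral_of_sum_two_squares hμ hef.symm
  have hμ8 := hμ.map modEight
  have hx8 := hx'.map modEight
  apply_fun modEight at h h'
  rw [map_sub, map_mul, map_mul, map_mul, map_pow, map_pow, hm₀'] at h
  rw [map_add, map_pow, map_pow] at h'
  have hsq : ∀ a : ZMod 8, IsUnit a → a ^ 2 = 1 := by decide
  have hsum : ∀ a b : ZMod 8, a ^ 2 + b ^ 2 ≠ 7 := by decide
  have key : ∀ l u v : ZMod 8, (l = 3 ∨ l = 7) → IsUnit u → u ≠ 7 →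
      5 * u = 1 - l * ((2 : ℕ) : ZMod 8) * v ^ 2 → u = 5 := by decide
  rw [hsq _ hx8, map_natCast modEight 2] at h
  exact key _ _ _ hl' hμ8 (h' ▸ hsum _ _) h

end Padics
end SubringsOfRat

/-! ### Rational solutions of ternary quadratic equations. -/

namespace SubringsOfRat

/-- A case of Legendre's theorem on ternary quadratic forms. -/
lemma exists_eq_sq_sub_mul_sq {n m : ℕ} (hn : 0 < n) (hm : ¬ IsSquare m) (hcop : n.Coprime m)
    (hs : IsSquare (m : ZMod n)) (ht : IsSquare (n : ZMod m)) :
    ∃ x y : ℚ, (n : ℚ) = x ^ 2 - m * y ^ 2 := by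
  have hm0 : 0 < m := by
    rcases Nat.eq_zero_or_pos m with rfl | h
    · exact absurd IsSquare.zero hm
    · exact h
  have hmQ : ∀ q : ℚ, q ^ 2 ≠ m := by
    intro q hq
    exact hm (Rat.isSquare_natCast_iff.mp ⟨q, by rw [← hq, sq]⟩)
  have : NeZero n := ⟨hn.ne'⟩
  have : NeZero m := ⟨hm0.ne'⟩
  obtain ⟨s, hs⟩ := hs
  obtain ⟨t, ht⟩ := ht
  set a := Nat.sqrt (n * m)
  set b := Nat.sqrt n
  set c := Nat.sqrt m
  have ha : a ^ 2 ≤ n * m := Nat.sqrt_le' _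
  have hb : b ^ 2 ≤ n := Nat.sqrt_le' _
  have hc : c ^ 2 ≤ m := Nat.sqrt_le' _
  have ha' : n * m < (a + 1) ^ 2 := Nat.lt_succ_sqrt' _
  have hb' : n < (b + 1) ^ 2 := Nat.lt_succ_sqrt' _
  have hc' : m < (c + 1) ^ 2 := Nat.lt_succ_sqrt' _
  -- These two strict inequalities later leave only two values for the quotient `k`.
  have hcm : c ^ 2 < m := lt_of_le_of_ne hc fun h => hm ⟨c, by rw [← h, sq]⟩
  have hanm : a ^ 2 < n * m := lt_of_le_of_ne ha fun h => hm <| by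
    obtain ⟨e, he⟩ := exists_eq_pow_of_mul_eq_pow (a := m) (b := n) (c := a) (k := 2)
      (by rw [Nat.isUnit_iff]; exact hcop.symm) (by rw [mul_comm, h])
    exact ⟨e, by rw [he, sq]⟩
  -- Thue's pigeonhole argument: the box has more than `n * m` points, so some nonzero difference
  -- `(x, y, z)` satisfies `x ≡ s y` modulo `n` and `x ≡ t z` modulo `m`. As `s² = m` and `t² = n`
  -- there, `n * m` divides `x² - m y² - n z²`.
  let F : Fin (a + 1) × Fin (b + 1) × Fin (c + 1) → ZMod n × ZMod m := fun v =>
    ((v.1 : ℕ) - s * (v.2.1 : ℕ), (v.1 : ℕ) - t * (v.2.2 : ℕ))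
  have hcard : Fintype.card (ZMod n × ZMod m) <
      Fintype.card (Fin (a + 1) × Fin (b + 1) × Fin (c + 1)) := by
    simp only [Fintype.card_prod, ZMod.card, Fintype.card_fin]
    refine lt_of_pow_lt_pow_left₀ 2 (Nat.zero_le _) ?_
    calc (n * m) ^ 2 = (n * m) * (n * m) := sq _
      _ < (a + 1) ^ 2 * ((b + 1) ^ 2 * (c + 1) ^ 2) :=
        Nat.mul_lt_mul'' ha' (Nat.mul_lt_mul'' hb' hc')
      _ = _ := by ring
  obtain ⟨v, w, hvw, hF⟩ := Fintype.exists_ne_map_eq_of_card_lt F hcard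
  obtain ⟨v1, v2, v3⟩ := v
  obtain ⟨w1, w2, w3⟩ := w
  simp only [F, Prod.mk.injEq] at hF
  obtain ⟨hF1, hF2⟩ := hF
  obtain ⟨x, hx⟩ : ∃ x : ℤ, x = (v1 : ℕ) - (w1 : ℕ) := ⟨_, rfl⟩
  obtain ⟨y, hy⟩ : ∃ x : ℤ, x = (v2 : ℕ) - (w2 : ℕ) := ⟨_, rfl⟩
  obtain ⟨z, hz⟩ : ∃ x : ℤ, x = (v3 : ℕ) - (w3 : ℕ) := ⟨_, rfl⟩
  have hxa : x ^ 2 ≤ (a : ℤ) ^ 2 := sq_le_sq' (by omega) (by omega)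
  have hyb : y ^ 2 ≤ (b : ℤ) ^ 2 := sq_le_sq' (by omega) (by omega)
  have hzc : z ^ 2 ≤ (c : ℤ) ^ 2 := sq_le_sq' (by omega) (by omega)
  have hne : ¬ (x = 0 ∧ y = 0 ∧ z = 0) := by
    rintro ⟨h1, h2, h3⟩
    apply hvw
    ext <;> simp <;> omega
  have h1 : (x : ZMod n) = s * y := by
    rw [hx, hy]
    push_cast
    linear_combination hF1
  have h2 : (x : ZMod m) = t * z := by
    rw [hx, hz]
    push_cast
    linear_combination hF2
  obtain ⟨k, hk⟩ : (n * m : ℤ) ∣ x ^ 2 - m * y ^ 2 - n * z ^ 2 := by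
    refine IsCoprime.mul_dvd (Nat.isCoprime_iff_coprime.mpr hcop) ?_ ?_
    · rw [← ZMod.intCast_zmod_eq_zero_iff_dvd]
      push_cast
      rw [h1, hs]
      simp
      ring
    · rw [← ZMod.intCast_zmod_eq_zero_iff_dvd]
      push_cast
      rw [h2, ht]
      simp
      ring
  have hnm : (0 : ℤ) < n * m := by positivity
  zify at hcm hanm hb
  have hk1 : k < 1 := by
    have : (n * m : ℤ) * k < n * m * 1 := by
      rw [← hk]
      have e1 : 0 ≤ (m : ℤ) * y ^ 2 := by positivity
      have e2 : 0 ≤ (n : ℤ) * z ^ 2 := by positivity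
      linarith
    exact lt_of_mul_lt_mul_left this hnm.le
  have hk2 : -2 < k := by
    have : (n * m : ℤ) * (-2) < n * m * k := by
      rw [← hk]
      have e1 : (m : ℤ) * y ^ 2 ≤ m * n :=
        mul_le_mul_of_nonneg_left (hyb.trans hb) (by positivity)
      have e2 : (n : ℤ) * z ^ 2 < n * m :=
        mul_lt_mul_of_pos_left (hzc.trans_lt hcm) (by positivity)
      nlinarith [sq_nonneg x]
    exact lt_of_mul_lt_mul_left this hnm.le
  obtain rfl | rfl : k = 0 ∨ k = -1 := by omega
  · have hkQ : (x : ℚ) ^ 2 - m * y ^ 2 = n * z ^ 2 := by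
      have : x ^ 2 - m * y ^ 2 = n * z ^ 2 := by linear_combination hk
      exact_mod_cast this
    have hz0 : (z : ℚ) ≠ 0 := by
      intro hz0
      rw [hz0] at hkQ
      have hy0 : (y : ℚ) = 0 := by
        by_contra hy0
        apply hmQ (x / y)
        field_simp
        linear_combination hkQ
      rw [hy0] at hkQ
      have hx0 : (x : ℚ) = 0 := by simpa using hkQ
      exact hne ⟨by exact_mod_cast hx0, by exact_mod_cast hy0, by exact_mod_cast hz0⟩
    refine ⟨x / z, y / z, ?_⟩
    field_simp
    linear_combination -hkQ
  · have hkQ : (x : ℚ) ^ 2 - m * y ^ 2 = n * (z ^ 2 - m) := by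
      have : x ^ 2 - m * y ^ 2 = n * (z ^ 2 - m) := by linear_combination hk
      exact_mod_cast this
    have hz0 : (z : ℚ) ^ 2 - m ≠ 0 := sub_ne_zero.mpr (hmQ z)
    -- The numerators are the coordinates of `(x + y√m)(z + √m)`, whose norm is `n (z² - m)²`.
    refine ⟨(x * z + m * y) / (z ^ 2 - m), (x + y * z) / (z ^ 2 - m), ?_⟩
    field_simp
    linear_combination (-(z : ℚ) ^ 2 + m) * hkQ

/-! ### Auxiliary primes and the definition of `p`-integrality in `ℚ`. -/

open NumberTheorySymbols

lemma isSquare_of_jacobiSym_eq_one {a q : ℕ} (hq : q.Prime) (h : J(a | q) = 1) :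
    IsSquare (a : ZMod q) := by
  have : Fact q.Prime := ⟨hq⟩
  rw [← jacobiSym.legendreSym.to_jacobiSym] at h
  have h0 : ((a : ℤ) : ZMod q) ≠ 0 := by
    intro h0
    rw [(legendreSym.eq_zero_iff q a).mpr h0] at h
    exact zero_ne_one h
  simpa using (legendreSym.eq_one_iff q h0).mp h

/-- By reciprocity the symbol of `p` at `l` equals that at `4p - 1`, where `4p ≡ 1` makes it `1`;
and `-1` is a nonresidue because `l ≡ 3` modulo `4`. -/
lemma not_isSquare_neg_of_mod {p l : ℕ} (hp : 0 < p) (hl : l.Prime) (h : l % (4 * p) = 4 * p - 1) :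
    ¬ IsSquare (-(p : ZMod l)) := by
  have : Fact l.Prime := ⟨hl⟩
  have h4 : l % 4 = 3 := by
    have := Nat.mod_mod_of_dvd l (dvd_mul_right 4 p)
    omega
  have hodd : Odd l := Nat.odd_iff.mpr (by omega)
  have hJp : J((p : ℤ) | l) = 1 := by
    rw [jacobiSym.mod_right _ hodd, Int.natAbs_natCast, h]
    have h1 : J((4 * p : ℤ) | 4 * p - 1) = 1 := by
      rw [jacobiSym.mod_left]
      have : (4 * p : ℤ) % ((4 * p - 1 : ℕ) : ℤ) = 1 := by
        have : (4 * p : ℤ) = 1 + ((4 * p - 1 : ℕ) : ℤ) := by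
          push_cast [Nat.cast_sub (show 1 ≤ 4 * p by omega)]
          ring
        rw [this, Int.add_emod_right]
        exact Int.emod_eq_of_lt (by norm_num) (by omega)
      rw [this, jacobiSym.one_left]
    have h2 : J((4 : ℤ) | 4 * p - 1) = 1 := by
      have : (4 : ℤ) = 2 ^ 2 := by norm_num
      rw [this]
      apply jacobiSym.sq_one'
      rw [Int.gcd_eq_natAbs]
      have : Odd (4 * p - 1) := Nat.odd_iff.mpr (by omega)
      simpa using this
    rw [jacobiSym.mul_left, h2, one_mul] at h1
    exact h1
  have hneg : J(-(p : ℤ) | l) = -1 := by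
    rw [jacobiSym.neg _ hodd, hJp, ZMod.χ₄_nat_three_mod_four h4, mul_one]
  intro hsq
  rw [← jacobiSym.legendreSym.to_jacobiSym, legendreSym.eq_neg_one_iff] at hneg
  apply hneg
  simpa using hsq

lemma exists_nonsquare_natCast {q : ℕ} (hq : q.Prime) (h2 : q ≠ 2) :
    ∃ a : ℕ, ¬ IsSquare (a : ZMod q) := by
  have : Fact q.Prime := ⟨hq⟩
  obtain ⟨a, ha⟩ := FiniteField.exists_nonsquare (F := ZMod q) (by rwa [ZMod.ringChar_zmod_n])
  exact ⟨a.val, by simpa using ha⟩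

lemma coprime_of_not_isSquare {a q : ℕ} (hq : q.Prime) (h : ¬ IsSquare (a : ZMod q)) :
    a.Coprime q := by
  rw [Nat.coprime_comm, hq.coprime_iff_not_dvd, ← ZMod.natCast_eq_zero_iff]
  intro h0
  exact h (h0 ▸ IsSquare.zero)

lemma jacobiSym_eq_neg_one {a q : ℕ} (hq : q.Prime) (h : ¬ IsSquare (a : ZMod q)) :
    J(a | q) = -1 := by
  have : Fact q.Prime := ⟨hq⟩
  rw [← jacobiSym.legendreSym.to_jacobiSym, legendreSym.eq_neg_one_iff]
  simpa using h

/-- The auxiliary primes `l` and `m₀` attached to a prime `p`. -/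
structure AuxiliaryPrimes (p l m₀ : ℕ) : Prop where
  prime_l : l.Prime
  prime_m₀ : m₀.Prime
  l_mod : l % (4 * p) = 4 * p - 1
  m₀_mod : m₀ % 4 = 1
  nonsquare : p ≠ 2 → ¬ IsSquare (m₀ : ZMod p)
  two : p = 2 → m₀ % 8 = 5
  coprime : m₀.Coprime (p * l)
  jacobi : J((p * l : ℕ) | m₀) = 1

/-- Dirichlet's theorem, used twice. The prime `m₀` is a nonresidue modulo `l` and modulo `p` (or
`5` modulo `8` if `p = 2`), so `p` and `l` both have symbol `-1` at `m₀` and their product has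
symbol `1`. The role of `l` is to cancel the sign of `p`. -/
lemma exists_auxiliaryPrimes {p : ℕ} (hp : p.Prime) : ∃ l m₀, AuxiliaryPrimes p l m₀ := by
  have hp0 := hp.pos
  obtain ⟨l, hlp, hl, hlmod⟩ := Nat.forall_exists_prime_gt_and_modEq p (q := 4 * p)
    (a := 4 * p - 1) (by omega) (by
      have := Nat.coprime_self_sub_right (n := 4 * p) (m := 1) (by omega)
      rw [Nat.coprime_comm]; simpa using this)
  have hlmod : l % (4 * p) = 4 * p - 1 := by
    rw [hlmod, Nat.mod_eq_of_lt (by omega)]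
  have hl4 : l % 4 = 3 := by
    have := Nat.mod_mod_of_dvd l (dvd_mul_right 4 p)
    omega
  have hl2 : l ≠ 2 := by
    rintro rfl
    omega
  obtain ⟨b, hb⟩ := exists_nonsquare_natCast hl hl2
  have hbl := coprime_of_not_isSquare hl hb
  have hpl : p.Coprime l := (Nat.coprime_primes hp hl).mpr (by omega)
  have h4l : Nat.Coprime 4 l := by
    have : Nat.Coprime 2 l := (Nat.coprime_primes Nat.prime_two hl).mpr hl2.symm
    exact Nat.Coprime.pow_left 2 this
  -- it suffices to find a residue class modulo `P * l` with the right properties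
  obtain ⟨P, a, hP0, hPl, haP, h⟩ : ∃ P a : ℕ, P ≠ 0 ∧ P.Coprime l ∧ a.Coprime P ∧
      ∀ m : ℕ, m ≡ a [MOD P] → m % 4 = 1 ∧ (p ≠ 2 → ¬ IsSquare (m : ZMod p)) ∧
        (p = 2 → m % 8 = 5) := by
    by_cases h2 : p = 2
    · refine ⟨8, 5, by norm_num, ?_, by norm_num, ?_⟩
      · have : Nat.Coprime 2 l := (Nat.coprime_primes Nat.prime_two hl).mpr hl2.symm
        exact Nat.Coprime.pow_left 3 this
      · intro m hm
        have : m % 8 = 5 := hm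
        exact ⟨by omega, fun h => absurd h2 h, fun _ => this⟩
    · obtain ⟨a₀, ha₀⟩ := exists_nonsquare_natCast hp h2
      have h4p : Nat.Coprime 4 p := by
        have : Nat.Coprime 2 p := (Nat.coprime_primes Nat.prime_two hp).mpr (Ne.symm h2)
        exact Nat.Coprime.pow_left 2 this
      obtain ⟨a, ha1, ha2⟩ := Nat.chineseRemainder h4p 1 a₀
      refine ⟨4 * p, a, by omega, h4l.mul_left hpl, ?_, ?_⟩
      · refine Nat.Coprime.mul_right ?_ ?_
        · rw [Nat.Coprime, ha1.gcd_eq, Nat.gcd_one_left]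
        · rw [Nat.Coprime, ha2.gcd_eq]
          exact coprime_of_not_isSquare hp ha₀
      · intro m hm
        refine ⟨(hm.of_mul_right p).trans ha1, fun _ => ?_, fun h => absurd h h2⟩
        rwa [(ZMod.natCast_eq_natCast_iff _ _ _).mpr ((hm.of_mul_left 4).trans ha2)]
  obtain ⟨k, hk1, hk2⟩ := Nat.chineseRemainder hPl a b
  have hkc : k.Coprime (P * l) := by
    refine Nat.Coprime.mul_right ?_ ?_
    · rwa [Nat.Coprime, hk1.gcd_eq]
    · rwa [Nat.Coprime, hk2.gcd_eq]
  obtain ⟨m₀, -, hm₀, hm₀k⟩ := Nat.forall_exists_prime_gt_and_modEq 0 (q := P * l)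
    (mul_ne_zero hP0 hl.ne_zero) hkc
  obtain ⟨hm4, hodd, htwo⟩ := h m₀ ((hm₀k.of_mul_right l).trans hk1)
  have hml : ¬ IsSquare (m₀ : ZMod l) := by
    rwa [(ZMod.natCast_eq_natCast_iff _ _ _).mpr ((hm₀k.of_mul_left P).trans hk2)]
  have hmodd : Odd m₀ := Nat.odd_iff.mpr (by omega)
  have hmp : m₀.Coprime p := by
    by_cases h2 : p = 2
    · rw [h2]
      exact Nat.coprime_two_right.mpr hmodd
    · exact coprime_of_not_isSquare hp (hodd h2)
  refine ⟨l, m₀, hl, hm₀, hlmod, hm4, hodd, htwo,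
    Nat.Coprime.mul_right hmp (coprime_of_not_isSquare hl hml), ?_⟩
  push_cast
  rw [jacobiSym.mul_left]
  have h1 : J((p : ℤ) | m₀) = -1 := by
    by_cases h2 : p = 2
    · have h8 := htwo h2
      rw [h2]
      push_cast
      rw [jacobiSym.at_two hmodd, ZMod.χ₈_nat_eq_if_mod_eight, if_neg (by omega), if_neg (by omega)]
    · rw [jacobiSym.quadratic_reciprocity_one_mod_four' (hp.odd_of_ne_two h2) hm4]
      exact jacobiSym_eq_neg_one hp (hodd h2)
  have h2 : J((l : ℤ) | m₀) = -1 := by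
    rw [jacobiSym.quadratic_reciprocity_one_mod_four' (hl.odd_of_ne_two hl2) hm4]
    exact jacobiSym_eq_neg_one hl hml
  rw [h1, h2]
  norm_num

lemma not_isSquare_mul_primes {p l : ℕ} (hp : p.Prime) (hl : l.Prime) (h : p ≠ l) :
    ¬ IsSquare (p * l) := by
  rintro ⟨a, ha⟩
  have hpa : p ∣ a := (Nat.Prime.dvd_mul hp).mp (ha ▸ dvd_mul_right p l) |>.elim id id
  obtain ⟨b, rfl⟩ := hpa
  have : p ∣ l := ⟨b * b, Nat.eq_of_mul_eq_mul_left hp.pos (by rw [ha]; ring)⟩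
  exact h ((Nat.prime_dvd_prime_iff_eq hp hl).mp this)

lemma isSquare_zmod_mul {a m n : ℕ} (h : m.Coprime n) (hm : IsSquare (a : ZMod m))
    (hn : IsSquare (a : ZMod n)) : IsSquare (a : ZMod (m * n)) := by
  obtain ⟨x, hx⟩ := hm
  obtain ⟨y, hy⟩ := hn
  refine ⟨(ZMod.chineseRemainder h).symm (x, y), (ZMod.chineseRemainder h).injective ?_⟩
  rw [map_mul, RingEquiv.apply_symm_apply, map_natCast, Prod.mk_mul_mk, ← hx, ← hy]
  rfl

/-- If `l` divided the sum, `-p` would be a square modulo `l`, unless `l` divided both `d` and `u`.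
-/
lemma AuxiliaryPrimes.coprime_sq_add {p l m₀ : ℕ} (hp : p.Prime) (h : AuxiliaryPrimes p l m₀)
    {d u : ℕ} (hdu : d.Coprime u) (hd : ¬ p ∣ d) : (d ^ 2 + p * u ^ 2).Coprime (p * l) := by
  have hl := h.prime_l
  have : Fact l.Prime := ⟨hl⟩
  refine Nat.Coprime.mul_right ?_ ?_
  · rw [Nat.coprime_comm, hp.coprime_iff_not_dvd]
    intro hdvd
    exact hd (hp.dvd_of_dvd_pow ((Nat.dvd_add_left (dvd_mul_right p _)).mp hdvd))
  · rw [Nat.coprime_comm, hl.coprime_iff_not_dvd]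
    intro hdvd
    rw [← ZMod.natCast_eq_zero_iff] at hdvd
    push_cast at hdvd
    apply not_isSquare_neg_of_mod hp.pos hl h.l_mod
    by_cases hu : (u : ZMod l) = 0
    · have hd0 : (d : ZMod l) = 0 := by simpa [hu] using hdvd
      rw [ZMod.natCast_eq_zero_iff] at hu hd0
      exact absurd (Nat.dvd_gcd hd0 hu) (by rw [hdu]; exact hl.one_lt.ne' ∘ Nat.dvd_one.mp)
    · refine ⟨d / u, ?_⟩
      field_simp
      linear_combination -hdvd

/-- Every positive integer prime to `p * l` is a norm from `ℚ(√m)`, for a prime `m` that satisfies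
certain conditions at `p`. -/
lemma AuxiliaryPrimes.exists_forms {p l m₀ : ℕ} (hp : p.Prime) (h : AuxiliaryPrimes p l m₀)
    {n : ℕ} (hn : 0 < n) (hcop : n.Coprime (p * l)) :
    ∃ m x y z w s t e f : ℚ, m ≠ 0 ∧ n = x ^ 2 - m * y ^ 2 ∧ m₀ * m = z ^ 2 - l * p * w ^ 2 ∧
      m = s ^ 2 - m₀ * t ^ 2 ∧ m = e ^ 2 + f ^ 2 := by
  have hl := h.prime_l
  have hm₀ := h.prime_m₀
  have hm₀4 := h.m₀_mod
  have hcop' : (n * m₀).Coprime (p * l) := hcop.mul_left h.coprime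
  have hpl : p ≠ l := by
    rintro rfl
    have h1 := h.l_mod
    rw [Nat.mod_eq_of_lt (by linarith [hp.pos])] at h1
    have := hp.one_lt
    omega
  -- The moduli have greatest common divisor exactly `4`, and `m₀ ≡ 1` modulo `4`, so the two
  -- congruences are compatible.
  obtain ⟨k, hk1, hk2⟩ := Nat.chineseRemainder' (n := 4 * (n * m₀)) (m := 4 * (p * l)) (a := 1)
    (b := m₀) (by
      rw [Nat.gcd_mul_left, hcop', mul_one]
      exact hm₀4.symm)
  have hne1 : 4 * (n * m₀) ≠ 0 := by have := hm₀.ne_zero; positivity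
  have hne2 : 4 * (p * l) ≠ 0 := by have := hp.ne_zero; have := hl.ne_zero; positivity
  have hkc : k.Coprime (Nat.lcm (4 * (n * m₀)) (4 * (p * l))) := by
    refine Nat.Coprime.coprime_dvd_right (Nat.lcm_dvd_mul _ _) (Nat.Coprime.mul_right ?_ ?_)
    · rw [Nat.Coprime, hk1.gcd_eq, Nat.gcd_one_left]
    · rw [Nat.Coprime, hk2.gcd_eq]
      refine Nat.Coprime.mul_right ?_ h.coprime
      have : Nat.Coprime m₀ 2 := Nat.coprime_two_right.mpr (Nat.odd_iff.mpr (by omega))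
      exact Nat.Coprime.pow_right 2 this
  obtain ⟨m, hmgt, hm, hmk⟩ := Nat.forall_exists_prime_gt_and_modEq m₀
    (Nat.lcm_ne_zero hne1 hne2) hkc
  have hm1 : m ≡ 1 [MOD 4 * (n * m₀)] := (hmk.of_dvd (Nat.dvd_lcm_left _ _)).trans hk1
  have hm2 : m ≡ m₀ [MOD 4 * (p * l)] := (hmk.of_dvd (Nat.dvd_lcm_right _ _)).trans hk2
  have hm4 : m % 4 = 1 := hm1.of_mul_right (n * m₀)
  have hmodd : Odd m := Nat.odd_iff.mpr (by omega)
  have hm₀odd : Odd m₀ := Nat.odd_iff.mpr (by omega)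
  have hmn : m ≡ 1 [MOD n] := hm1.of_dvd (Dvd.intro_left (4 * m₀) (by ring))
  have hmm₀ : m ≡ 1 [MOD m₀] := hm1.of_dvd (Dvd.intro_left (4 * n) (by ring))
  -- Reciprocity in periodic form: for odd `m`, the symbol of `a` at `m` depends only on `m` modulo
  -- `4 * a`.
  have hJ : ∀ a : ℕ, m ≡ 1 [MOD 4 * a] → a ≠ 0 → IsSquare (a : ZMod m) := by
    intro a ha ha0
    apply isSquare_of_jacobiSym_eq_one hm
    have : m % (4 * a) = 1 := by
      rw [ha, Nat.mod_eq_of_lt (by omega)]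
    rw [jacobiSym.mod_right' a hmodd, this, jacobiSym.one_right]
  have hone : ∀ a : ℕ, m ≡ 1 [MOD a] → IsSquare (m : ZMod a) := by
    intro a ha
    rw [(ZMod.natCast_eq_natCast_iff _ _ _).mpr ha]
    exact ⟨1, by simp⟩
  have hprime : ∀ {q : ℕ}, q.Prime → ¬ IsSquare q := fun hq h => hq.prime.not_isSquare h
  obtain ⟨x, y, hxy⟩ := exists_eq_sq_sub_mul_sq hn (hprime hm)
    (by rw [Nat.coprime_comm, Nat.Coprime, hmn.gcd_eq, Nat.gcd_one_left]) (hone n hmn)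
    (hJ n (hm1.of_dvd (Dvd.intro_left m₀ (by ring))) hn.ne')
  obtain ⟨s, t, hst⟩ := exists_eq_sq_sub_mul_sq hm.pos (hprime hm₀)
    (by rw [Nat.Coprime, hmm₀.gcd_eq, Nat.gcd_one_left])
    (hJ m₀ (hm1.of_dvd (Dvd.intro_left n (by ring))) hm₀.ne_zero) (hone m₀ hmm₀)
  have hmpl : m ≡ m₀ [MOD p * l] := hm2.of_mul_left 4
  have hmc : m.Coprime (p * l) := by
    rw [Nat.Coprime, hmpl.gcd_eq]
    exact h.coprime
  obtain ⟨z, w, hzw⟩ := exists_eq_sq_sub_mul_sq (n := m₀ * m) (m := p * l)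
    (Nat.mul_pos hm₀.pos hm.pos) (not_isSquare_mul_primes hp hl hpl) (h.coprime.mul_left hmc)
    (by
      -- The choice `m > m₀` makes the two primes distinct. The symbol of `p * l` is the same at `m`
      -- and at `m₀`, as these agree modulo `4 * (p * l)`.
      refine isSquare_zmod_mul ((Nat.coprime_primes hm₀ hm).mpr hmgt.ne)
        (isSquare_of_jacobiSym_eq_one hm₀ h.jacobi) (isSquare_of_jacobiSym_eq_one hm ?_)
      rw [jacobiSym.mod_right' _ hmodd, hm2, ← jacobiSym.mod_right' _ hm₀odd]
      exact h.jacobi)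
    ⟨m₀, by
      rw [Nat.cast_mul, (ZMod.natCast_eq_natCast_iff _ _ _).mpr hmpl]⟩
  have : Fact m.Prime := ⟨hm⟩
  obtain ⟨e, f, hef⟩ := Nat.Prime.sq_add_sq (p := m) (by omega)
  refine ⟨m, x, y, z, w, s, t, e, f, by exact_mod_cast hm.ne_zero, hxy, ?_, hst, ?_⟩
  · push_cast at hzw
    rw [hzw]
    ring
  · exact_mod_cast hef.symm

/-- An existential definition over `ℚ` of the rationals with denominator prime to `p`. -/
theorem AuxiliaryPrimes.not_dvd_den_iff {p l m₀ : ℕ} (hp : p.Prime) (h : AuxiliaryPrimes p l m₀)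
    (r : ℚ) : ¬ p ∣ r.den ↔ ∃ m x y z w s t e f : ℚ, m ≠ 0 ∧ 1 + p * r ^ 2 = x ^ 2 - m * y ^ 2 ∧
      m₀ * m = z ^ 2 - l * p * w ^ 2 ∧ m = s ^ 2 - m₀ * t ^ 2 ∧ m = e ^ 2 + f ^ 2 := by
  constructor
  · intro hr
    have hc := h.coprime_sq_add hp (d := r.den) (u := r.num.natAbs) r.reduced.symm hr
    obtain ⟨m, x, y, z, w, s, t, e, f, hm, hn, h1, h2, h3⟩ :=
      h.exists_forms hp (by have := r.den_pos; positivity) hc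
    refine ⟨m, x / r.den, y / r.den, z, w, s, t, e, f, hm, ?_, h1, h2, h3⟩
    have hd : (r.den : ℚ) ≠ 0 := by exact_mod_cast r.den_nz
    have hu : ((r.num.natAbs : ℕ) : ℚ) ^ 2 = (r.num : ℚ) ^ 2 := by
      rw [Nat.cast_natAbs, Int.cast_abs, sq_abs]
    push_cast at hn
    have hr' : r = r.num / r.den := r.num_div_den.symm
    have : 1 + p * r ^ 2 = (r.den ^ 2 + p * r.num ^ 2) / r.den ^ 2 := by
      conv_lhs => rw [hr']
      field_simp
    rw [this, ← hu]
    field_simp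
    linear_combination hn
  · rintro ⟨m, x, y, z, w, s, t, e, f, hm, hn, h1, h2, h3⟩
    have : Fact p.Prime := ⟨hp⟩
    have hm' : (m : ℚ_[p]) ≠ 0 := by exact_mod_cast hm
    have hn' : 1 + (p : ℚ_[p]) * r ^ 2 = x ^ 2 - m * y ^ 2 := by exact_mod_cast hn
    have h1' : (m₀ : ℚ_[p]) * m = z ^ 2 - l * p * w ^ 2 := by exact_mod_cast h1
    have h2' : (m : ℚ_[p]) = s ^ 2 - m₀ * t ^ 2 := by exact_mod_cast h2
    have h3' : (m : ℚ_[p]) = e ^ 2 + f ^ 2 := by exact_mod_cast h3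
    have hnorm : ‖(r : ℚ_[p])‖ ≤ 1 := by
      by_cases hp2 : p = 2
      · subst hp2
        refine Padics.norm_le_one_of_forms_two (h.two rfl) ?_ hm' hn' h1' h2' h3'
        have := h.l_mod
        omega
      · refine Padics.norm_le_one_of_forms_of_odd (h.nonsquare hp2) ?_ hm' hn' h1' h2' h3'
        intro hdvd
        have := h.l_mod
        have hd : p ∣ l % (4 * p) := (Nat.dvd_mod_iff (dvd_mul_left p 4)).mpr hdvd
        rw [this] at hd
        have h4 : p ∣ 1 := by
          have := Nat.dvd_sub (dvd_mul_left p 4) hd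
          rwa [Nat.sub_sub_self (by have := hp.pos; omega)] at this
        exact hp.one_lt.ne' (Nat.dvd_one.mp h4)
    rw [Padic.norm_rat_le_one_iff_padicValuation_le_one, Rat.padicValuation_le_one_iff] at hnorm
    exact hnorm

end SubringsOfRat

/-! ### Uniformly diophantine predicates. -/

namespace SubringsOfRat
open MvPolynomial

lemma map_aeval_int {A B : Type*} [CommRing A] [CommRing B] [Algebra ℤ A] [Algebra ℤ B]
    {σ : Type*} (f : A →+* B) (v : σ → A)
    (g : MvPolynomial σ ℤ) : f (aeval v g) = aeval (fun i => f (v i)) g := by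
  induction g using MvPolynomial.induction_on with
  | C a => simp
  | add p q hp hq => simp only [map_add, hp, hq]
  | mul_X p i hp => simp only [map_mul, hp, aeval_X]

lemma aeval_aeval_int {A : Type*} [CommRing A] {σ τ : Type*} (v : τ → A)
    (F : σ → MvPolynomial τ ℤ) (g : MvPolynomial σ ℤ) :
    aeval v (aeval F g) = aeval (fun i => aeval v (F i)) g :=
  map_aeval_int (aeval v : MvPolynomial τ ℤ →ₐ[ℤ] A).toRingHom F g

lemma aeval_congr_vars {A : Type*} [CommRing A] {σ : Type*} {v w : σ → A} {g : MvPolynomial σ ℤ}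
    (h : ∀ i ∈ g.vars, v i = w i) : aeval v g = aeval w g :=
  eval₂Hom_congr' rfl (fun i hi _ => h i hi) rfl

/-- The variables of `g(X, Y₀, Y₁, …)` among the `Y_i`. -/
noncomputable def indices (g : PolyXY) : Finset ℕ := Finset.eraseNone g.vars

lemma aeval_congr_indices {A : Type*} [CommRing A] (g : PolyXY) (q : A) {y z : ℕ → A}
    (h : ∀ i ∈ indices g, y i = z i) :
    aeval (fun o : Option ℕ => o.elim q y) g = aeval (fun o : Option ℕ => o.elim q z) g := by
  apply aeval_congr_vars
  rintro (_ | i) hi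
  · rfl
  · exact h i (Finset.mem_eraseNone.mpr hi)

lemma eval_substX {A : Type*} [CommRing A] (g : PolyXY) (q : A) (x : ℕ → A) :
    eval x (substX g q) = aeval (fun o : Option ℕ => o.elim q x) g := by
  rw [substX, map_aeval_int (eval x)]
  congr 2
  funext o
  cases o <;> simp

lemma substX_mem_HTP {A : Type*} [CommRing A] (g : PolyXY) (q : A) :
    substX g q ∈ HTP A ↔ ∃ y : ℕ → A, aeval (fun o : Option ℕ => o.elim q y) g = 0 := by
  simp only [HTP, Set.mem_ofPred_eq, eval_substX]

lemma ExistentiallyDefinesInt.of_ringEquiv {A B : Type*} [CommRing A] [CommRing B] (e : A ≃+* B)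
    {g : PolyXY} (h : ExistentiallyDefinesInt A g) : ExistentiallyDefinesInt B g := by
  intro q
  have h1 : (∃ n : ℤ, (n : B) = q) ↔ ∃ n : ℤ, (n : A) = e.symm q := by
    refine exists_congr fun n => ?_
    rw [← map_intCast e n, eq_comm, ← e.symm_apply_eq, eq_comm]
  rw [h1, h, substX_mem_HTP, substX_mem_HTP]
  constructor
  · rintro ⟨y, hy⟩
    refine ⟨fun i => e (y i), ?_⟩
    have := map_aeval_int e.toRingHom (fun o : Option ℕ => o.elim (e.symm q) y) g
    rw [hy, map_zero] at this
    rw [this]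
    congr 2
    funext o
    cases o <;> simp
  · rintro ⟨y, hy⟩
    refine ⟨fun i => e.symm (y i), ?_⟩
    have := map_aeval_int e.symm.toRingHom (fun o : Option ℕ => o.elim q y) g
    rw [hy, map_zero] at this
    rw [this]
    congr 2
    funext o
    cases o <;> simp

/-- A predicate on tuples indexed by `α` is diophantine, uniformly in a family of rings. -/
def IsDioph {I : Type} (A : I → Type) [∀ i, CommRing (A i)] {α : Type}
    (P : ∀ i, (α → A i) → Prop) : Prop :=
  ∃ (β : Type) (_ : Countable β) (g : MvPolynomial (α ⊕ β) ℤ),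
    ∀ i v, P i v ↔ ∃ y : β → A i, aeval (Sum.elim v y) g = 0

namespace IsDioph

variable {I : Type} {A : I → Type} [∀ i, CommRing (A i)] {α : Type}

lemma congr {P Q : ∀ i, (α → A i) → Prop} (hP : IsDioph A P) (h : ∀ i v, Q i v ↔ P i v) :
    IsDioph A Q := by
  obtain ⟨β, hβ, g, hg⟩ := hP
  exact ⟨β, hβ, g, fun i v => (h i v).trans (hg i v)⟩

lemma polyEq (f g : MvPolynomial α ℤ) : IsDioph A fun _ v => aeval v f = aeval v g := by
  refine ⟨Empty, inferInstance, rename Sum.inl (f - g), fun i v => ?_⟩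
  simp only [aeval_rename, Sum.elim_comp_inl, map_sub, sub_eq_zero, exists_const]

lemma comap {α' : Type} {P : ∀ i, (α → A i) → Prop} (hP : IsDioph A P) (e : α → α') :
    IsDioph A fun i (v : α' → A i) => P i (v ∘ e) := by
  obtain ⟨β, hβ, g, hg⟩ := hP
  refine ⟨β, hβ, rename (Sum.map e id) g, fun i v => ?_⟩
  simp only [hg, aeval_rename, Sum.elim_comp_map, Function.comp_id]

lemma ex {γ : Type} [Countable γ] {P : ∀ i, (α ⊕ γ → A i) → Prop} (hP : IsDioph A P) :
    IsDioph A fun i v => ∃ w : γ → A i, P i (Sum.elim v w) := by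
  obtain ⟨β, hβ, g, hg⟩ := hP
  refine ⟨γ ⊕ β, inferInstance, rename (Equiv.sumAssoc α γ β) g, fun i v => ?_⟩
  simp only [hg, aeval_rename]
  have key : ∀ (w : γ → A i) (y : β → A i), Sum.elim v (Sum.elim w y) ∘ Equiv.sumAssoc α γ β =
      Sum.elim (Sum.elim v w) y := by
    intro w y
    funext s
    rcases s with (_ | _) | _ <;> rfl
  constructor
  · rintro ⟨w, y, h⟩
    exact ⟨Sum.elim w y, by rwa [key]⟩
  · rintro ⟨z, h⟩
    refine ⟨z ∘ Sum.inl, z ∘ Sum.inr, ?_⟩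
    rwa [← key, Sum.elim_comp_inl_inr]

lemma or [∀ i, IsDomain (A i)] {P Q : ∀ i, (α → A i) → Prop} (hP : IsDioph A P)
    (hQ : IsDioph A Q) : IsDioph A fun i v => P i v ∨ Q i v := by
  obtain ⟨β, hβ, f, hf⟩ := hP
  obtain ⟨γ, hγ, g, hg⟩ := hQ
  refine ⟨β ⊕ γ, inferInstance, rename (Sum.map id Sum.inl) f * rename (Sum.map id Sum.inr) g,
    fun i v => ?_⟩
  simp only [hf, hg, map_mul, aeval_rename, Sum.elim_comp_map, Function.comp_id, mul_eq_zero]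
  constructor
  · rintro (⟨y, hy⟩ | ⟨y, hy⟩)
    · exact ⟨Sum.elim y 0, Or.inl hy⟩
    · exact ⟨Sum.elim 0 y, Or.inr hy⟩
  · rintro ⟨y, hy | hy⟩
    · exact Or.inl ⟨_, hy⟩
    · exact Or.inr ⟨_, hy⟩

/-- In each ring of the family, a sum of two squares vanishes only trivially. -/
def SumSqAnisotropic {I : Type} (A : I → Type) [∀ i, CommRing (A i)] : Prop :=
  ∀ i (x y : A i), x ^ 2 + y ^ 2 = 0 → x = 0 ∧ y = 0

lemma and (hA : SumSqAnisotropic A) {P Q : ∀ i, (α → A i) → Prop} (hP : IsDioph A P)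
    (hQ : IsDioph A Q) : IsDioph A fun i v => P i v ∧ Q i v := by
  obtain ⟨β, hβ, f, hf⟩ := hP
  obtain ⟨γ, hγ, g, hg⟩ := hQ
  refine ⟨β ⊕ γ, inferInstance,
    rename (Sum.map id Sum.inl) f ^ 2 + rename (Sum.map id Sum.inr) g ^ 2, fun i v => ?_⟩
  simp only [hf, hg, map_add, map_pow, aeval_rename, Sum.elim_comp_map, Function.comp_id]
  constructor
  · rintro ⟨⟨y, hy⟩, ⟨z, hz⟩⟩
    exact ⟨Sum.elim y z, by simp [hy, hz]⟩
  · rintro ⟨y, hy⟩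
    obtain ⟨h1, h2⟩ := hA i _ _ hy
    exact ⟨⟨_, h1⟩, ⟨_, h2⟩⟩

lemma const_true : IsDioph A fun _ (_ : α → _) => True :=
  (polyEq 0 0).congr fun _ _ => by simp

lemma ball_finset (hA : SumSqAnisotropic A) {κ : Type} (s : Finset κ)
    {P : κ → ∀ i, (α → A i) → Prop} (hP : ∀ k ∈ s, IsDioph A (P k)) :
    IsDioph A fun i v => ∀ k ∈ s, P k i v := by
  classical
  induction s using Finset.induction_on with
  | empty => exact const_true.congr fun _ _ => by simp
  | insert a s _ ih =>
    refine ((hP a (Finset.mem_insert_self a s)).and hA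
      (ih fun k hk => hP k (Finset.mem_insert_of_mem hk))).congr fun i v => ?_
    simp only [Finset.forall_mem_insert]

/-- A uniform diophantine definition of `ℤ`, as a single polynomial `g(X, Y₀, Y₁, …)`. -/
lemma exists_polyXY (h : IsDioph A fun i (v : Unit → A i) => ∃ n : ℤ, (n : A i) = v ()) :
    ∃ g : PolyXY, ∀ i, ExistentiallyDefinesInt (A i) g := by
  obtain ⟨β, hβ, f, hf⟩ := h
  obtain ⟨e, he⟩ := Countable.exists_injective_nat β
  refine ⟨rename (Sum.elim (fun _ => none) (fun b => some (e b))) f, fun i q => ?_⟩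
  rw [substX_mem_HTP]
  refine (hf i fun _ => q).trans ?_
  have key : ∀ y : ℕ → A i, (fun o : Option ℕ => o.elim q y) ∘
      Sum.elim (fun _ : Unit => none) (fun b => some (e b)) = Sum.elim (fun _ => q) (y ∘ e) := by
    intro y
    funext s
    cases s <;> rfl
  simp only [aeval_rename, key]
  constructor
  · rintro ⟨y, hy⟩
    -- Indices outside the range of `e` do not occur in the renamed polynomial, so the value `0`
    -- there is harmless.
    refine ⟨Function.extend e y 0, ?_⟩
    rwa [Function.extend_comp he]
  · rintro ⟨y, hy⟩
    exact ⟨_, hy⟩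

end IsDioph

/-! ### Diophantine predicates over `ℚ`, and transfer from `ℚ` to its subrings. -/

lemma sumSqAnisotropic_rat : IsDioph.SumSqAnisotropic fun _ : Unit => ℚ := by
  intro _ x y h
  constructor <;> nlinarith [sq_nonneg x, sq_nonneg y]

lemma sumSqAnisotropic_subring : IsDioph.SumSqAnisotropic fun S : Subring ℚ => S := by
  intro S x y h
  have := sumSqAnisotropic_rat () (x : ℚ) y (by exact_mod_cast congrArg Subtype.val h)
  exact ⟨Subtype.ext this.1, Subtype.ext this.2⟩

/-- Clearing denominators in `h(a₀/b, a₁/b, …)`. -/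
lemma exists_homogenization {σ : Type*} (h : MvPolynomial σ ℤ) :
    ∃ (N : ℕ) (H : MvPolynomial (Option σ) ℤ), ∀ (b : ℚ) (a : σ → ℚ), b ≠ 0 →
      aeval (fun o : Option σ => o.elim b a) H = b ^ N * aeval (fun i => a i / b) h := by
  induction h using MvPolynomial.induction_on with
  | C c => exact ⟨0, C c, fun b a _ => by simp⟩
  | add p q hp hq =>
    obtain ⟨N, H, hH⟩ := hp
    obtain ⟨M, G, hG⟩ := hq
    refine ⟨N + M, X none ^ M * H + X none ^ N * G, fun b a hb => ?_⟩
    simp only [map_add, map_mul, map_pow, aeval_X, hH b a hb, hG b a hb, Option.elim_none]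
    ring
  | mul_X p i hp =>
    obtain ⟨N, H, hH⟩ := hp
    refine ⟨N + 1, H * X (some i), fun b a hb => ?_⟩
    simp only [map_mul, aeval_X, hH b a hb, Option.elim_some]
    field_simp
    ring

lemma not_dvd_den_isDioph {p : ℕ} (hp : p.Prime) {α : Type} (a : α) :
    IsDioph (fun _ : Unit => ℚ) fun _ v => ¬ p ∣ (v a).den := by
  obtain ⟨l, m₀, h⟩ := exists_auxiliaryPrimes hp
  -- The witnesses are `m`, an inverse of `m` encoding `m ≠ 0`, and the eight arguments of the
  -- forms.
  let V : Fin 10 → MvPolynomial (α ⊕ Fin 10) ℤ := fun k => X (Sum.inr k)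
  have hA := sumSqAnisotropic_rat
  refine (IsDioph.ex (γ := Fin 10)
    ((IsDioph.polyEq (V 0 * V 1) 1).and hA <|
    (IsDioph.polyEq (1 + (p : MvPolynomial (α ⊕ Fin 10) ℤ) * X (Sum.inl a) ^ 2)
      (V 2 ^ 2 - V 0 * V 3 ^ 2)).and hA <|
    (IsDioph.polyEq ((m₀ : MvPolynomial (α ⊕ Fin 10) ℤ) * V 0)
      (V 4 ^ 2 - (l : MvPolynomial (α ⊕ Fin 10) ℤ) * (p : MvPolynomial (α ⊕ Fin 10) ℤ) *
        V 5 ^ 2)).and hA <|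
    (IsDioph.polyEq (V 0) (V 6 ^ 2 - (m₀ : MvPolynomial (α ⊕ Fin 10) ℤ) * V 7 ^ 2)).and hA <|
    (IsDioph.polyEq (V 0) (V 8 ^ 2 + V 9 ^ 2)))).congr fun _ v => ?_
  rw [h.not_dvd_den_iff hp]
  simp only [V, map_add, map_sub, map_mul, map_pow, map_one, map_natCast, aeval_X, Sum.elim_inl,
    Sum.elim_inr]
  constructor
  · rintro ⟨m, x, y, z, w, s, t, e, f, hm, h⟩
    exact ⟨![m, m⁻¹, x, y, z, w, s, t, e, f], mul_inv_cancel₀ hm, h⟩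
  · rintro ⟨u, hm, h⟩
    exact ⟨_, _, _, _, _, _, _, _, _, left_ne_zero_of_mul_eq_one hm, h⟩

/-- A definition of `ℤ` in `ℚ` can be interpreted in all subrings `S` of `ℚ` at once, as the nonzero
elements of `S` are those with a multiple of the form `1 + x² + y² + z² + w²`. -/
lemma exists_polyXY_forall_subring (h : IntExistentiallyDefinable ℚ) :
    ∃ g : PolyXY, ∀ S : Subring ℚ, ExistentiallyDefinesInt S g := by
  obtain ⟨g, hg⟩ := h
  obtain ⟨N, H, hH⟩ := exists_homogenization g
  apply IsDioph.exists_polyXY (A := fun S : Subring ℚ => S)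
  let V : Fin 6 → MvPolynomial (Unit ⊕ (Fin 6 ⊕ ℕ)) ℤ := fun k => X (Sum.inr (Sum.inl k))
  -- With `V 0` as common denominator `b`, the homogenized equation receives the numerators `q * b`
  -- for `X` and `a i` for `Y_i`.
  let F : Option (Option ℕ) → MvPolynomial (Unit ⊕ (Fin 6 ⊕ ℕ)) ℤ := fun o =>
    o.elim (V 0) fun o' => o'.elim (X (Sum.inl ()) * V 0) fun i => X (Sum.inr (Sum.inr i))
  refine (IsDioph.ex (γ := Fin 6 ⊕ ℕ)
    ((IsDioph.polyEq (V 0 * V 1) (1 + V 2 ^ 2 + V 3 ^ 2 + V 4 ^ 2 + V 5 ^ 2)).and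
      sumSqAnisotropic_subring (IsDioph.polyEq (aeval F H) 0))).congr fun S v => ?_
  simp only [aeval_aeval_int]
  have hF : ∀ w : Fin 6 ⊕ ℕ → S, (fun o => ((aeval (Sum.elim v w) (F o) : S) : ℚ)) =
      fun o => o.elim (w (Sum.inl 0) : ℚ) fun o' : Option ℕ =>
        o'.elim ((v () : ℚ) * w (Sum.inl 0)) fun i => (w (Sum.inr i) : ℚ) := by
    intro w
    funext o
    rcases o with _ | _ | i <;> simp [F, V]
  have hcoe : ∀ w : Fin 6 ⊕ ℕ → S, aeval (fun o => aeval (Sum.elim v w) (F o)) H = 0 ↔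
      aeval (fun o : Option (Option ℕ) => o.elim (w (Sum.inl 0) : ℚ) fun o' : Option ℕ =>
        o'.elim ((v () : ℚ) * w (Sum.inl 0)) fun i => (w (Sum.inr i) : ℚ)) H = 0 := by
    intro w
    rw [← hF w, ← map_eq_zero_iff S.subtype Subtype.val_injective, map_aeval_int]
    rfl
  simp only [map_zero, hcoe]
  have hq : (∃ n : ℤ, (n : S) = v ()) ↔ ∃ n : ℤ, (n : ℚ) = v () := by
    refine exists_congr fun n => ?_
    rw [Subtype.ext_iff]
    simp
  rw [hq, hg, substX_mem_HTP]
  simp only [V, map_add, map_mul, map_pow, map_one, aeval_X, Sum.elim_inr]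
  constructor
  · rintro ⟨y, hy⟩
    obtain ⟨n, hn⟩ := (hg _).mpr ((substX_mem_HTP g (v () : ℚ)).mpr ⟨y, hy⟩)
    set b : ℕ := ∏ i ∈ indices g, (y i).den with hb
    have hb0 : b ≠ 0 := Finset.prod_ne_zero_iff.mpr fun i _ => (y i).den_nz
    have ha : ∀ i, ∃ a : ℤ, i ∈ indices g → (a : ℚ) = b * y i := by
      intro i
      by_cases hi : i ∈ indices g
      · obtain ⟨c, hc⟩ := Finset.dvd_prod_of_mem (fun i => (y i).den) hi
        refine ⟨c * (y i).num, fun _ => ?_⟩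
        rw [hb, hc]
        push_cast
        have := Rat.mul_den_eq_num (y i)
        linear_combination -(c : ℚ) * this
      · exact ⟨0, fun h => absurd h hi⟩
    choose a ha using ha
    -- Lagrange's theorem for `b² - 1`: the cofactor of `b` may be `b` itself, and all these
    -- witnesses are integers, hence lie in every `S`.
    obtain ⟨x₁, x₂, x₃, x₄, hx⟩ := Nat.sum_four_squares (b ^ 2 - 1)
    have hx' : b * b = 1 + x₁ ^ 2 + x₂ ^ 2 + x₃ ^ 2 + x₄ ^ 2 := by
      have : 1 ≤ b ^ 2 := Nat.one_le_pow _ _ (Nat.pos_of_ne_zero hb0)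
      rw [← sq]
      omega
    refine ⟨Sum.elim ![(b : S), b, x₁, x₂, x₃, x₄] fun i => (a i : S), ?_, ?_⟩
    · simpa using congrArg (Nat.cast (R := S)) hx'
    · have hbQ : (b : ℚ) ≠ 0 := by exact_mod_cast hb0
      simp only [Sum.elim_inl, Sum.elim_inr, Matrix.cons_val_zero, SubringClass.coe_natCast,
        SubringClass.coe_intCast]
      rw [hH _ _ hbQ]
      refine mul_eq_zero_of_right _ (Eq.trans ?_ hy)
      apply aeval_congr_vars
      rintro (_ | i) hi
      · simp only [Option.elim]
        field_simp
      · simp only [Option.elim]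
        rw [ha i (Finset.mem_eraseNone.mpr hi)]
        field_simp
  · rintro ⟨w, hw, hw0⟩
    have hb : (w (Sum.inl 0) : ℚ) ≠ 0 := by
      intro h0
      have hw' := congrArg (Subtype.val) hw
      push_cast at hw'
      rw [h0] at hw'
      nlinarith [sq_nonneg (w (Sum.inl 2) : ℚ), sq_nonneg (w (Sum.inl 3) : ℚ),
        sq_nonneg (w (Sum.inl 4) : ℚ), sq_nonneg (w (Sum.inl 5) : ℚ)]
    rw [hH _ _ hb] at hw0
    refine ⟨fun i => w (Sum.inr i) / w (Sum.inl 0), ?_⟩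
    rw [← (mul_eq_zero_iff_left (pow_ne_zero N hb)).mp hw0]
    congr 2
    funext o
    cases o
    · simp only [Option.elim]
      field_simp
    · rfl

end SubringsOfRat

/-! ### Subrings of `ℚ` as points of Cantor space. -/

namespace SubringsOfRat
open MvPolynomial Topology

lemma one_div_mem_R {W : PrimeSets} {n : ℕ} (hn : n ≠ 0)
    (h : ∀ p : Nat.Primes, (p : ℕ) ∣ n → W p = true) : 1 / (n : ℚ) ∈ R W := by
  induction n using Nat.recOnMul with
  | zero => exact absurd rfl hn
  | one => simp
  | prime p hp => exact Subring.subset_closure ⟨⟨p, hp⟩, h ⟨p, hp⟩ dvd_rfl, rfl⟩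
  | mul a b ha hb =>
    have ha0 := left_ne_zero_of_mul hn
    have hb0 := right_ne_zero_of_mul hn
    have : 1 / ((a * b : ℕ) : ℚ) = 1 / (a : ℚ) * (1 / (b : ℚ)) := by
      push_cast
      field_simp
    rw [this]
    exact (R W).mul_mem (ha ha0 fun p hp => h p (hp.mul_right b))
      (hb hb0 fun p hp => h p (hp.mul_left a))

lemma mem_R {W : PrimeSets} {q : ℚ} :
    q ∈ R W ↔ ∀ p : Nat.Primes, (p : ℕ) ∣ q.den → W p = true := by
  constructor
  · intro hq
    induction hq using Subring.closure_induction with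
    | mem x hx =>
      obtain ⟨l, hl, rfl⟩ := hx
      intro p hp
      have h1 : (1 / ((l : ℕ) : ℚ)).den = l := by
        rw [one_div, Rat.inv_natCast_den_of_pos l.2.pos]
      rw [h1, Nat.prime_dvd_prime_iff_eq p.2 l.2] at hp
      rwa [Subtype.ext hp]
    | zero => intro p hp; exact absurd (Nat.dvd_one.mp hp) p.2.one_lt.ne'
    | one => intro p hp; exact absurd (Nat.dvd_one.mp hp) p.2.one_lt.ne'
    | add x y _ _ hx hy =>
      intro p hp
      exact ((Nat.Prime.dvd_mul p.2).mp (hp.trans (Rat.add_den_dvd x y))).elim (hx p) (hy p)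
    | neg x _ hx => intro p hp; exact hx p (by simpa using hp)
    | mul x y _ _ hx hy =>
      intro p hp
      exact ((Nat.Prime.dvd_mul p.2).mp (hp.trans (Rat.mul_den_dvd x y))).elim (hx p) (hy p)
  · intro h
    have : q = q.num * (1 / (q.den : ℚ)) := by
      rw [mul_one_div, Rat.num_div_den]
    rw [this]
    exact (R W).mul_mem (intCast_mem (R W) _) (one_div_mem_R q.den_nz h)

/-- The equation `g(q, Y₀, Y₁, …) = 0` is solvable in the subring `S` of `ℚ`, which contains `q`. -/
def Solvable (g : PolyXY) (S : Subring ℚ) (q : ℚ) : Prop :=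
  q ∈ S ∧ ∃ y : ℕ → ℚ, (∀ i, y i ∈ S) ∧ aeval (fun o : Option ℕ => o.elim q y) g = 0

lemma substX_mem_HTP_subring (g : PolyXY) (S : Subring ℚ) (q : S) :
    substX g q ∈ HTP S ↔ Solvable g S q := by
  have key : ∀ y : ℕ → S, aeval (fun o : Option ℕ => o.elim q y) g = 0 ↔
      aeval (fun o : Option ℕ => o.elim (q : ℚ) fun i => (y i : ℚ)) g = 0 := by
    intro y
    rw [← map_eq_zero_iff S.subtype Subtype.val_injective, map_aeval_int]
    have : (fun o : Option ℕ => S.subtype (o.elim q y)) =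
        fun o => o.elim (q : ℚ) fun i => (y i : ℚ) := by
      funext o
      cases o <;> rfl
    rw [this]
  rw [substX_mem_HTP]
  simp only [key]
  constructor
  · rintro ⟨y, hy⟩
    exact ⟨q.2, fun i => y i, fun i => (y i).2, hy⟩
  · rintro ⟨-, y, hyS, hy⟩
    exact ⟨fun i => ⟨y i, hyS i⟩, hy⟩

lemma existentiallyDefinesInt_subring_iff (g : PolyXY) (S : Subring ℚ) :
    ExistentiallyDefinesInt S g ↔ ∀ q : ℚ, (∃ n : ℤ, (n : ℚ) = q) ↔ Solvable g S q := by
  have hq : ∀ q : S, (∃ n : ℤ, (n : S) = q) ↔ ∃ n : ℤ, (n : ℚ) = q := by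
    intro q
    refine exists_congr fun n => ?_
    rw [Subtype.ext_iff]
    simp
  constructor
  · intro h q
    by_cases hqS : q ∈ S
    · rw [← substX_mem_HTP_subring g S ⟨q, hqS⟩, ← h, hq]
    · refine ⟨?_, fun h => absurd h.1 hqS⟩
      rintro ⟨n, rfl⟩
      exact absurd (intCast_mem S n) hqS
  · intro h q
    rw [substX_mem_HTP_subring, hq, h]

lemma Solvable.mono {g : PolyXY} {S T : Subring ℚ} (hST : S ≤ T) {q : ℚ} (h : Solvable g S q) :
    Solvable g T q := by
  obtain ⟨hq, y, hy, h0⟩ := h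
  exact ⟨hST hq, y, fun i => hST (hy i), h0⟩

lemma R_mono {V W : PrimeSets} (h : ∀ p, V p = true → W p = true) : R V ≤ R W := by
  intro q hq
  rw [mem_R] at hq ⊢
  exact fun p hp => h p (hq p hp)

/-- A solution uses the inverses of only finitely many primes. -/
lemma Solvable.exists_finset {g : PolyXY} {W : PrimeSets} {q : ℚ} (h : Solvable g (R W) q) :
    ∃ F : Finset Nat.Primes, (∀ p ∈ F, W p = true) ∧
      ∀ V : PrimeSets, (∀ p ∈ F, V p = true) → Solvable g (R V) q := by
  classical
  obtain ⟨hq, y, hy, h0⟩ := h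
  have hfin : ∀ r : ℚ, {p : Nat.Primes | (p : ℕ) ∣ r.den}.Finite := by
    intro r
    refine Set.Finite.of_finite_image (f := Subtype.val) ((Nat.divisors r.den).finite_toSet.subset ?_)
      Subtype.val_injective.injOn
    rintro _ ⟨p, hp, rfl⟩
    exact Nat.mem_divisors.mpr ⟨hp, r.den_nz⟩
  refine ⟨(hfin q).toFinset ∪ (indices g).biUnion fun i => (hfin (y i)).toFinset, ?_, ?_⟩
  · intro p hp
    simp only [Finset.mem_union, Finset.mem_biUnion, Set.Finite.mem_toFinset] at hp
    rcases hp with hp | ⟨i, -, hp⟩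
    · exact mem_R.mp hq p hp
    · exact mem_R.mp (hy i) p hp
  · intro V hV
    simp only [Finset.mem_union, Finset.mem_biUnion, Set.Finite.mem_toFinset] at hV
    -- Variables that do not occur in `g` are reset to `0`, since their old values may have
    -- arbitrary denominators.
    refine ⟨mem_R.mpr fun p hp => hV p (Or.inl hp), fun i => if i ∈ indices g then y i else 0,
      fun i => ?_, ?_⟩
    · dsimp only
      split_ifs with hi
      · exact mem_R.mpr fun p hp => hV p (Or.inr ⟨i, hi, hp⟩)
      · exact (R V).zero_mem
    · rw [← h0]
      apply aeval_congr_indices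
      intro i hi
      rw [if_pos hi]

lemma isOpen_forall_eq_true (F : Finset Nat.Primes) :
    IsOpen {W : PrimeSets | ∀ p ∈ F, W p = true} := by
  have : {W : PrimeSets | ∀ p ∈ F, W p = true} = ⋂ p ∈ F, {W | W p = true} := by
    ext W
    simp
  rw [this]
  exact isOpen_biInter_finset fun p _ =>
    (isOpen_discrete {true}).preimage (continuous_apply p : Continuous fun W : PrimeSets => W p)

lemma isOpen_setOf_solvable (g : PolyXY) (q : ℚ) : IsOpen {W : PrimeSets | Solvable g (R W) q} := by
  rw [isOpen_iff_forall_mem_open]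
  intro W hW
  obtain ⟨F, hF, h⟩ := Solvable.exists_finset hW
  exact ⟨_, h, isOpen_forall_eq_true F, hF⟩

lemma nthPrime_injective : Function.Injective nthPrime := by
  intro i j h
  exact Nat.nth_injective Nat.infinite_setOfPred_prime (congrArg Subtype.val h)

lemma nthPrime_surjective : Function.Surjective nthPrime := by
  intro p
  exact ⟨Nat.count Nat.Prime p, Subtype.ext (Nat.nth_count p.2)⟩

lemma isOpen_basicOpen (σ : List Bool) : IsOpen (basicOpen σ) := by
  have : basicOpen σ = ⋂ i : Fin σ.length, {W | W (nthPrime i) = σ[i]} := by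
    ext W
    simp only [basicOpen, Set.mem_ofPred_eq, Set.mem_iInter]
    exact ⟨fun h i => h i i.2, fun h i hi => h ⟨i, hi⟩⟩
  rw [this]
  exact isOpen_iInter_of_finite fun i =>
    (isOpen_discrete {σ[i]}).preimage
      (continuous_apply (nthPrime i) : Continuous fun W : PrimeSets => W (nthPrime i))

lemma exists_basicOpen_subset {U : Set PrimeSets} (hU : IsOpen U) {W : PrimeSets} (hW : W ∈ U) :
    ∃ σ : List Bool, W ∈ basicOpen σ ∧ basicOpen σ ⊆ U := by
  obtain ⟨I, u, hu, hsub⟩ := isOpen_pi_iff.mp hU W hW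
  choose e he using nthPrime_surjective
  -- A prefix long enough to decide every prime in the finite support `I`.
  refine ⟨List.ofFn fun i : Fin (I.sup e + 1) => W (nthPrime i), ?_, ?_⟩
  · intro i hi
    rw [List.getElem_ofFn]
  · intro V hV
    apply hsub
    intro p hp
    have hi : e p < I.sup e + 1 := Nat.lt_succ_of_le (Finset.le_sup hp)
    have := hV (e p) (by simpa using hi)
    simp only [List.getElem_ofFn, he] at this
    rw [this]
    exact (hu p hp).2

/-- The set of primes that contains every prime not excluded by `σ`. -/
noncomputable def maximalExtension (σ : List Bool) : PrimeSets := by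
  classical
  exact fun p => decide (∀ (i : ℕ) (hi : i < σ.length), nthPrime i = p → σ[i] = true)

lemma maximalExtension_eq_true {σ : List Bool} {p : Nat.Primes} :
    maximalExtension σ p = true ↔
      ∀ (i : ℕ) (hi : i < σ.length), nthPrime i = p → σ[i] = true := by
  simp [maximalExtension]

lemma maximalExtension_mem (σ : List Bool) : maximalExtension σ ∈ basicOpen σ := by
  intro i hi
  rw [Bool.eq_iff_iff, maximalExtension_eq_true]
  constructor
  · intro h
    exact h i hi rfl
  · intro h j hj hij
    obtain rfl := nthPrime_injective hij
    exact h

lemma le_maximalExtension {σ : List Bool} {V : PrimeSets} (hV : V ∈ basicOpen σ) :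
    R V ≤ R (maximalExtension σ) := by
  apply R_mono
  intro p hp
  rw [maximalExtension_eq_true]
  rintro i hi rfl
  rw [← hV i hi, hp]

/-! ### Baire category and HTP-generic sets. -/

lemma solvable_eq (f : MvPolynomial ℕ ℤ) :
    solvable f = {W : PrimeSets | Solvable (rename some f) (R W) 0} := by
  ext W
  simp only [solvable, Set.mem_ofPred_eq]
  rw [← ZeroMemClass.coe_zero (R W), ← substX_mem_HTP_subring, substX_mem_HTP]
  simp only [HTP, Set.mem_ofPred_eq, eval_map, aeval_rename]
  rfl

/-- This makes genericity applicable to `g` at integer values of `X`, the only ones for which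
substitution yields an integer polynomial. -/
lemma solvable_substX (g : PolyXY) (n : ℤ) :
    solvable (substX g n) = {W : PrimeSets | Solvable g (R W) n} := by
  ext W
  simp only [solvable, Set.mem_ofPred_eq]
  have : MvPolynomial.map (Int.castRingHom (R W)) (substX g n) = substX g (n : R W) := by
    rw [substX, substX, map_aeval_int (MvPolynomial.map (Int.castRingHom (R W)))]
    congr 2
    funext o
    cases o <;> simp
  rw [this, substX_mem_HTP_subring]
  simp

lemma isOpen_solvable (f : MvPolynomial ℕ ℤ) : IsOpen (solvable f) := by
  rw [solvable_eq]
  exact isOpen_setOf_solvable _ _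

/-- The frontier of an open set is closed with empty interior. -/
lemma isMeagre_boundary (f : MvPolynomial ℕ ℤ) : IsMeagre (boundary f) := by
  have : boundary f = frontier (solvable f) := by
    ext W
    rw [(isOpen_solvable f).frontier_eq]
    simp [boundary, and_comm]
  rw [this]
  refine IsNowhereDense.isMeagre ?_
  rw [isClosed_frontier.isNowhereDense_iff, ← frontier_compl]
  exact interior_frontier (isOpen_solvable f).isClosed_compl


lemma countable_mvPolynomial_int (σ : Type) [Countable σ] : Countable (MvPolynomial σ ℤ) := by
  rw [← Cardinal.mk_le_aleph0_iff]
  refine MvPolynomial.cardinalMk_le_max.trans ?_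
  simp [Cardinal.mk_le_aleph0_iff.mpr]

lemma isMeagre_setOf_not_HTPGeneric : IsMeagre {W : PrimeSets | ¬ HTPGeneric W} := by
  have := countable_mvPolynomial_int ℕ
  have h : {W : PrimeSets | ¬ HTPGeneric W} = ⋃ f : MvPolynomial ℕ ℤ, boundary f := by
    ext W
    simp [HTPGeneric]
  rw [h]
  exact isMeagre_iUnion isMeagre_boundary

lemma exists_HTPGeneric_mem {U : Set PrimeSets} (hU : IsOpen U) (hne : U.Nonempty) :
    ∃ V ∈ U, HTPGeneric V := by
  have hd : Dense {W : PrimeSets | ¬ HTPGeneric W}ᶜ :=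
    dense_of_mem_residual isMeagre_setOf_not_HTPGeneric
  obtain ⟨V, hVU, hV⟩ := hd.inter_open_nonempty U hU hne
  exact ⟨V, hVU, not_not.mp hV⟩

theorem exists_uniform_of_not_isMeagre (h : ¬ IsMeagre E) : ∃ (σ : List Bool) (g : PolyXY),
    ∀ V ∈ basicOpen σ, HTPGeneric V → ExistentiallyDefinesInt (R V) g := by
  have := countable_mvPolynomial_int (Option ℕ)
  have hE : E = ⋃ g : PolyXY, {W | ExistentiallyDefinesInt (R W) g} := by
    ext W
    simp [E, IntExistentiallyDefinable]
  rw [hE] at h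
  obtain ⟨g, hg⟩ : ∃ g : PolyXY, ¬ IsNowhereDense {W | ExistentiallyDefinesInt (R W) g} := by
    by_contra! hall
    exact h (isMeagre_iUnion fun g => (hall g).isMeagre)
  obtain ⟨W₀, hW₀⟩ := Set.nonempty_iff_ne_empty.mpr hg
  obtain ⟨σ, -, hσ⟩ := exists_basicOpen_subset isOpen_interior hW₀
  have hdense : ∀ U : Set PrimeSets, IsOpen U → ∀ V ∈ U, V ∈ basicOpen σ →
      ∃ W ∈ U, ExistentiallyDefinesInt (R W) g := by
    intro U hU V hVU hV
    obtain ⟨W, hWU, hW⟩ := mem_closure_iff.mp (interior_subset (hσ hV)) U hU hVU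
    exact ⟨W, hWU, hW⟩
  refine ⟨σ, g, fun V hV hgen => ?_⟩
  rw [existentiallyDefinesInt_subring_iff]
  intro q
  constructor
  · rintro ⟨n, rfl⟩
    by_contra hns
    have hVs : V ∉ solvable (substX g n) := by
      rw [solvable_substX]
      exact hns
    -- Genericity spreads the failure at `V` to a neighborhood, which contains a `W` where `g` does
    -- define `ℤ`.
    have hVi : V ∈ interior (solvable (substX g n))ᶜ := by
      by_contra hVi
      exact hgen (Set.mem_iUnion.mpr ⟨_, hVs, hVi⟩)
    obtain ⟨W, hWU, hW⟩ := hdense _ isOpen_interior V hVi hV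
    apply interior_subset hWU
    rw [solvable_substX]
    exact ((existentiallyDefinesInt_subring_iff g _).mp hW n).mp ⟨n, rfl⟩
  · intro hs
    -- Solvability is open, so this direction needs no genericity.
    obtain ⟨W, hWs, hW⟩ := hdense _ (isOpen_setOf_solvable g q) V hs hV
    exact ((existentiallyDefinesInt_subring_iff g _).mp hW q).mpr hWs

/-- Otherwise Baire's theorem would yield a generic set in the basic open set of `σ` and outside
`E`. -/
theorem not_isMeagre_of_exists_uniform (h : ∃ (σ : List Bool) (g : PolyXY),
    ∀ V ∈ basicOpen σ, HTPGeneric V → ExistentiallyDefinesInt (R V) g) : ¬ IsMeagre E := by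
  obtain ⟨σ, g, h⟩ := h
  intro hE
  have hd : Dense (E ∪ {W : PrimeSets | ¬ HTPGeneric W})ᶜ :=
    dense_of_mem_residual (hE.union isMeagre_setOf_not_HTPGeneric)
  obtain ⟨V, hVσ, hV⟩ :=
    hd.inter_open_nonempty _ (isOpen_basicOpen σ) ⟨_, maximalExtension_mem σ⟩
  simp only [Set.mem_compl_iff, Set.mem_union, not_or, Set.mem_ofPred_eq, not_not] at hV
  exact hV.1 ⟨g, h V hVσ hV.2⟩

/-- A polynomial that works for the generic extensions of `σ` also works for the largest one, whose
ring is semilocal. -/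
lemma existentiallyDefinesInt_maximalExtension {σ : List Bool} {g : PolyXY}
    (h : ∀ V ∈ basicOpen σ, HTPGeneric V → ExistentiallyDefinesInt (R V) g) :
    ExistentiallyDefinesInt (R (maximalExtension σ)) g := by
  rw [existentiallyDefinesInt_subring_iff]
  intro q
  constructor
  · rintro hq
    obtain ⟨V, hV, hgen⟩ :=
      exists_HTPGeneric_mem (isOpen_basicOpen σ) ⟨_, maximalExtension_mem σ⟩
    exact (((existentiallyDefinesInt_subring_iff g _).mp (h V hV hgen) q).mp hq).mono
      (le_maximalExtension hV)
  · intro hs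
    -- A solution in the largest ring survives on a neighborhood, which contains a generic `V`
    -- extending `σ`.
    obtain ⟨V, ⟨hV, hVs⟩, hgen⟩ := exists_HTPGeneric_mem
      ((isOpen_basicOpen σ).inter (isOpen_setOf_solvable g q)) ⟨_, maximalExtension_mem σ, hs⟩
    exact ((existentiallyDefinesInt_subring_iff g _).mp (h V hV hgen) q).mpr hVs

lemma mem_R_maximalExtension {σ : List Bool} {q : ℚ} : q ∈ R (maximalExtension σ) ↔
    ∀ i ∈ Finset.univ.filter (fun i : Fin σ.length => σ[i] = false),
      ¬ (nthPrime i : ℕ) ∣ q.den := by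
  simp only [mem_R, maximalExtension_eq_true, Finset.mem_filter, Finset.mem_univ, true_and]
  constructor
  · intro h i hi hdvd
    have := h _ hdvd i i.2 rfl
    rw [Fin.getElem_fin] at hi
    rw [hi] at this
    exact Bool.false_ne_true this
  · rintro h p hp i hi rfl
    by_contra hne
    exact h ⟨i, hi⟩ (by simpa using hne) hp

/-- Only the primes at the `false` entries of `σ` are not inverted, so membership is a finite
conjunction of integrality conditions. -/
lemma isDioph_mem_R_maximalExtension (σ : List Bool) {α : Type} (a : α) :
    IsDioph (fun _ : Unit => ℚ) fun _ v => v a ∈ R (maximalExtension σ) :=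
  (IsDioph.ball_finset sumSqAnisotropic_rat
    (Finset.univ.filter fun i : Fin σ.length => σ[i] = false)
    (P := fun i _ v => ¬ (nthPrime i : ℕ) ∣ (v a).den) fun i _ => not_dvd_den_isDioph (nthPrime i).2 a).congr fun _ _ => mem_R_maximalExtension

/-- The definition in the semilocal ring is relativized to `ℚ`: membership in that ring is demanded
of `q` and of the finitely many `Y_i` that occur in `g`. -/
theorem intExistentiallyDefinable_rat (h : ∃ (σ : List Bool) (g : PolyXY),
    ∀ V ∈ basicOpen σ, HTPGeneric V → ExistentiallyDefinesInt (R V) g) :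
    IntExistentiallyDefinable ℚ := by
  obtain ⟨σ, g, h⟩ := h
  have hg := (existentiallyDefinesInt_subring_iff g _).mp
    (existentiallyDefinesInt_maximalExtension h)
  obtain ⟨f, hf⟩ := IsDioph.exists_polyXY (A := fun _ : Unit => ℚ) <| by
    refine (IsDioph.ex (γ := ℕ) ((isDioph_mem_R_maximalExtension σ (Sum.inl ())).and
      sumSqAnisotropic_rat <| (IsDioph.ball_finset sumSqAnisotropic_rat (indices g)
        fun i _ => isDioph_mem_R_maximalExtension σ (Sum.inr i)).and sumSqAnisotropic_rat <|
      IsDioph.polyEq (rename (fun o : Option ℕ => o.elim (Sum.inl ()) Sum.inr) g) 0)).congr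
        fun _ v => ?_
    rw [hg]
    have key : ∀ y : ℕ → ℚ, Sum.elim v y ∘ (fun o : Option ℕ => o.elim (Sum.inl ()) Sum.inr) =
        fun o => o.elim (v ()) y := by
      intro y
      funext o
      cases o <;> rfl
    simp only [Sum.elim_inl, Sum.elim_inr, aeval_rename, key, map_zero]
    constructor
    · rintro ⟨hq, y, hy, h0⟩
      exact ⟨y, hq, fun i _ => hy i, h0⟩
    · rintro ⟨y, hq, hy, h0⟩
      refine ⟨hq, fun i => if i ∈ indices g then y i else 0, fun i => ?_, ?_⟩
      · dsimp only
        split_ifs with hi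
        · exact hy i hi
        · exact Subring.zero_mem _
      · rw [← h0]
        apply aeval_congr_indices
        intro i hi
        rw [if_pos hi]
  exact ⟨f, hf ()⟩

end SubringsOfRat

/-! ### Existential first-order formulas versus single polynomials. -/

namespace SubringsOfRat
open MvPolynomial FirstOrder FirstOrder.Ring

lemma exists_polynomial_of_term {γ : Type} (t : Language.ring.Term γ) :
    ∃ f : MvPolynomial γ ℤ, ∀ (A : Type) [CommRing A] (v : γ → A),
      letI := compatibleRingOfRing A
      t.realize v = aeval v f := by
  induction t with
  | var a => exact ⟨X a, fun A _ v => by simp⟩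
  | func f ts ih =>
    choose F hF using ih
    cases f with
    | add => exact ⟨F 0 + F 1, fun A _ v => by
        let := compatibleRingOfRing A
        exact (CompatibleRing.funMap_add _).trans (by simp [hF])⟩
    | mul => exact ⟨F 0 * F 1, fun A _ v => by
        let := compatibleRingOfRing A
        exact (CompatibleRing.funMap_mul _).trans (by simp [hF])⟩
    | neg => exact ⟨-F 0, fun A _ v => by
        let := compatibleRingOfRing A
        exact (CompatibleRing.funMap_neg _).trans (by simp [hF])⟩
    | zero => exact ⟨0, fun A _ v => by
        let := compatibleRingOfRing A
        exact (CompatibleRing.funMap_zero _).trans (by simp)⟩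
    | one => exact ⟨1, fun A _ v => by
        let := compatibleRingOfRing A
        exact (CompatibleRing.funMap_one _).trans (by simp)⟩

lemma exists_term_of_polynomial {γ : Type} (f : MvPolynomial γ ℤ) :
    ∃ t : Language.ring.Term γ, ∀ (A : Type) [CommRing A] (v : γ → A),
      letI := compatibleRingOfRing A
      t.realize v = aeval v f := by
  refine ⟨termOfFreeCommRing ((freeCommRingEquivMvPolynomialInt γ).symm f), fun A _ v => ?_⟩
  let := compatibleRingOfRing A
  rw [realize_termOfFreeCommRing]
  obtain ⟨p, rfl⟩ := (freeCommRingEquivMvPolynomialInt γ).surjective f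
  rw [RingEquiv.symm_apply_apply]
  induction p using FreeCommRing.induction_on with
  | neg_one => simp
  | of a => simp [freeCommRingEquivMvPolynomialInt]
  | add x y hx hy => simp only [map_add, hx, hy]
  | mul x y hx hy => simp only [map_mul, hx, hy]

lemma isExistential_exs {α : Type} {n : ℕ} {φ : Language.ring.BoundedFormula α n}
    (h : φ.IsExistential) : φ.exs.IsExistential := by
  induction n with
  | zero => exact h
  | succ n ih => exact ih h.ex

theorem exists_formula_of_polyXY (h : ∃ g : PolyXY, ∀ S : Subring ℚ, ExistentiallyDefinesInt S g) :
    ∃ φ : Language.ring.Formula (Fin 1), φ.IsExistential ∧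
      ∀ S : Subring ℚ, FormulaDefinesInt S φ := by
  obtain ⟨g, hg⟩ := h
  obtain ⟨s, p, rfl⟩ := exists_finset_rename g
  let e := s.equivFin
  let ι : {o // o ∈ s} → Fin 1 ⊕ Fin s.card := fun o =>
    (o : Option ℕ).elim (Sum.inl 0) fun _ => Sum.inr (e o)
  obtain ⟨t, ht⟩ := exists_term_of_polynomial (rename ι p)
  refine ⟨(t.bdEqual 0).exs, isExistential_exs
    (Language.BoundedFormula.IsAtomic.equal _ _).isExistential, fun S => ?_⟩
  let := compatibleRingOfRing S
  intro q
  rw [hg S, substX_mem_HTP, Language.BoundedFormula.realize_exs]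
  simp only [Language.BoundedFormula.realize_bdEqual, ht, realize_zero, aeval_rename]
  constructor
  · rintro ⟨y, hy⟩
    -- If `none` lies in `s`, its slot among the bound variables is unused, as `ι` sends `none` to
    -- the free variable; hence the default `0`.
    refine ⟨fun j => ((e.symm j : Option ℕ)).elim 0 y, ?_⟩
    rw [← hy]
    congr 2
    funext o
    obtain ⟨_ | i, ho⟩ := o <;> simp [ι]
  · rintro ⟨x, hx⟩
    refine ⟨fun i => if h : some i ∈ s then x (e ⟨some i, h⟩) else 0, ?_⟩
    rw [← hx]
    congr 2
    funext o
    obtain ⟨_ | i, ho⟩ := o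
    · simp [ι]
    · simp [ι, ho]

/-! ### Existential formulas over fields. -/

section Field

variable {I : Type} {A : I → Type} [∀ i, CommRing (A i)] [∀ i, IsDomain (A i)]

/-- Rabinowitsch's trick: a difference is nonzero exactly when it is invertible. -/
lemma IsDioph.polyNe (hA : ∀ i (x : A i), x ≠ 0 → ∃ y, x * y = 1) {α : Type}
    (f g : MvPolynomial α ℤ) : IsDioph A fun _ v => aeval v f ≠ aeval v g := by
  refine (IsDioph.ex (γ := Unit)
    (IsDioph.polyEq (rename Sum.inl (f - g) * X (Sum.inr ())) 1)).congr fun i v => ?_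
  simp only [map_mul, aeval_rename, Sum.elim_comp_inl, aeval_X, Sum.elim_inr, map_one, map_sub]
  constructor
  · intro h
    obtain ⟨y, hy⟩ := hA i _ (sub_ne_zero.mpr h)
    exact ⟨fun _ => y, hy⟩
  · rintro ⟨w, hw⟩
    exact sub_ne_zero.mp (left_ne_zero_of_mul_eq_one hw)

/-- Implication is the primitive connective, so the induction must carry a formula together with its
negation. -/
lemma IsDioph.realize_of_isQF (hA : ∀ i (x : A i), x ≠ 0 → ∃ y, x * y = 1)
    (hsq : IsDioph.SumSqAnisotropic A) {α : Type} {n : ℕ} {φ : Language.ring.BoundedFormula α n}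
    (hφ : φ.IsQF) :
    IsDioph A (fun i (v : α ⊕ Fin n → A i) =>
      letI := compatibleRingOfRing (A i)
      φ.Realize (v ∘ Sum.inl) (v ∘ Sum.inr)) ∧
    IsDioph A (fun i (v : α ⊕ Fin n → A i) =>
      letI := compatibleRingOfRing (A i)
      ¬ φ.Realize (v ∘ Sum.inl) (v ∘ Sum.inr)) := by
  induction hφ with
  | falsum =>
    exact ⟨(IsDioph.polyEq 0 1).congr fun i v => by simp [Language.BoundedFormula.Realize],
      IsDioph.const_true.congr fun i v => by simp [Language.BoundedFormula.Realize]⟩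
  | of_isAtomic h =>
    cases h with
    | equal t₁ t₂ =>
      obtain ⟨f₁, hf₁⟩ := exists_polynomial_of_term t₁
      obtain ⟨f₂, hf₂⟩ := exists_polynomial_of_term t₂
      exact ⟨(IsDioph.polyEq f₁ f₂).congr fun i v => by
          simp only [Language.BoundedFormula.realize_bdEqual, Sum.elim_comp_inl_inr, hf₁, hf₂],
        (IsDioph.polyNe hA f₁ f₂).congr fun i v => by
          simp only [Language.BoundedFormula.realize_bdEqual, Sum.elim_comp_inl_inr, hf₁, hf₂, ne_eq]⟩
    | rel r => exact isEmptyElim r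
  | imp _ _ ih₁ ih₂ =>
    exact ⟨(ih₁.2.or ih₂.1).congr fun i v => by
        simp only [Language.BoundedFormula.realize_imp]; tauto,
      (ih₁.1.and hsq ih₂.2).congr fun i v => by
        simp only [Language.BoundedFormula.realize_imp]; tauto⟩

lemma IsDioph.realize_of_isExistential (hA : ∀ i (x : A i), x ≠ 0 → ∃ y, x * y = 1)
    (hsq : IsDioph.SumSqAnisotropic A) {α : Type} {n : ℕ} {φ : Language.ring.BoundedFormula α n}
    (hφ : φ.IsExistential) :
    IsDioph A fun i (v : α ⊕ Fin n → A i) =>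
      letI := compatibleRingOfRing (A i)
      φ.Realize (v ∘ Sum.inl) (v ∘ Sum.inr) := by
  induction hφ with
  | of_isQF h => exact (IsDioph.realize_of_isQF hA hsq h).1
  | @ex n φ _ ih =>
    -- The quantified variable is the last of the bound variables; `c` moves it to the separate
    -- `Unit` summand.
    let c : α ⊕ Fin (n + 1) → (α ⊕ Fin n) ⊕ Unit := Sum.elim (fun a => Sum.inl (Sum.inl a))
      (Fin.snoc (α := fun _ => (α ⊕ Fin n) ⊕ Unit) (fun j => Sum.inl (Sum.inr j)) (Sum.inr ()))
    refine (IsDioph.ex (γ := Unit) (ih.comap c)).congr fun i v => ?_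
    let := compatibleRingOfRing (A i)
    simp only [Language.BoundedFormula.realize_ex]
    have h1 : ∀ w : Unit → A i, (Sum.elim v w ∘ c) ∘ Sum.inl = v ∘ Sum.inl := fun w => rfl
    have h2 : ∀ w : Unit → A i, (Sum.elim v w ∘ c) ∘ Sum.inr =
        Fin.snoc (α := fun _ => A i) (v ∘ Sum.inr) (w ()) := by
      intro w
      funext j
      refine Fin.lastCases ?_ (fun j => ?_) j <;> simp [c]
    simp only [h1, h2]
    exact ⟨fun ⟨a, ha⟩ => ⟨fun _ => a, ha⟩, fun ⟨w, hw⟩ => ⟨w (), hw⟩⟩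

end Field

/-- Only the subring `⊤` is needed: it is a field, so negated equations in the formula are
diophantine. -/
theorem intExistentiallyDefinable_of_formula
    (h : ∃ φ : Language.ring.Formula (Fin 1), φ.IsExistential ∧
      ∀ S : Subring ℚ, FormulaDefinesInt S φ) : IntExistentiallyDefinable ℚ := by
  obtain ⟨φ, hφ, h⟩ := h
  have hinv : ∀ (_ : Unit) (x : (⊤ : Subring ℚ)), x ≠ 0 → ∃ y, x * y = 1 := by
    intro _ x hx
    refine ⟨⟨(x : ℚ)⁻¹, trivial⟩, Subtype.ext ?_⟩
    exact mul_inv_cancel₀ fun h0 => hx (Subtype.ext h0)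
  have hd := IsDioph.realize_of_isExistential (A := fun _ : Unit => (⊤ : Subring ℚ)) hinv
    (fun _ => sumSqAnisotropic_subring ⊤) hφ
  obtain ⟨g, hg⟩ := IsDioph.exists_polyXY (A := fun _ : Unit => (⊤ : Subring ℚ)) <| by
    refine (hd.comap (Sum.elim (fun _ => ()) Fin.elim0)).congr fun _ v => ?_
    rw [h ⊤ (v ())]
    let := compatibleRingOfRing (⊤ : Subring ℚ)
    rw [Language.Formula.Realize, Subsingleton.elim (default : Fin 0 → (⊤ : Subring ℚ))]
    rfl
  exact ⟨g, (hg ()).of_ringEquiv Subring.topEquiv⟩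

end SubringsOfRat
open SubringsOfRat in
/-- The last two conditions are both readings of "a single existential formula defines `ℤ` in every
subring of `ℚ`": an existential first-order formula in the language of rings, and one of the form
`∃ Y₀ Y₁ …, g(X, Y₀, Y₁, …) = 0`. -/
theorem theorem5p4 :
    List.TFAE [
      ¬ IsMeagre E,
      ∃ (σ : List Bool) (g : PolyXY),
        ∀ V ∈ basicOpen σ, HTPGeneric V → ExistentiallyDefinesInt (R V) g,
      IntExistentiallyDefinable ℚ,
      ∃ φ : FirstOrder.Language.ring.Formula (Fin 1), φ.IsExistential ∧
        ∀ S : Subring ℚ, FormulaDefinesInt S φ,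
      ∃ g : PolyXY, ∀ S : Subring ℚ, ExistentiallyDefinesInt S g] := by
  tfae_have 1 → 2 := exists_uniform_of_not_isMeagre
  tfae_have 2 → 1 := not_isMeagre_of_exists_uniform
  tfae_have 2 → 3 := intExistentiallyDefinable_rat
  tfae_have 3 → 5 := exists_polyXY_forall_subring
  -- The empty string imposes no condition, so its basic open set is the whole space.
  tfae_have 5 → 2 := fun ⟨g, hg⟩ => ⟨[], g, fun V _ _ => hg (R V)⟩
  tfae_have 5 → 4 := exists_formula_of_polyXY
  tfae_have 4 → 3 := intExistentiallyDefinable_of_formula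
  tfae_finish
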